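/- A convex body in $\mathbb{R}^2$ is a compact convex set with non-empty interior. For $0<p<\infty$ let $L^p(G)$ be the usual real Lebesgue space on $G$ with its (quasi-)norm, and let $L^\infty(G)=C(G)$ be the space of continuous functions on $G$ with the uniform norm. For $r\in\mathbb{N}=\{1,2,\dots\}$, $h\in\mathbb{R}^2$ and $f:G\to\mathbb{R}$ put $\triangle_h^r(f,G,\eta)=\sum_{j=0}^r(-1)^{r+j}\binom rj f(\eta+jh)$ if the segment $[\eta,\eta+rh]$ is contained in $G$, and $\triangle_h^r(f,G,\eta)=0$ otherwise. For a set $\mathcal{E}$ of unit vectors spanning $\mathbb{R}^2$ put $$\omega^r(f,G;\mathcal{E})_p=\sup_{\xi\in\mathcal{E}}\ \sup_{0<u\le \operatorname{diam}(G)}\|\triangle_{u\xi}^r(f,G,\cdot)\|_{L^p(G)},$$ and let $$E_{r-1}(f;\mathcal{E})_{L^p(G)}=\inf_{Q\in\Pi_{r-1}(\mathcal{E})}\|f-Q\|_{L^p(G)},$$ where $\Pi_{r-1}(\mathcal{E})$ is the set of all algebraic polynomials $Q$ on $\mathbb{R}^2$ such that for all $x\in\mathbb{R}^2$ and $e\in\mathcal{E}$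 the function $t\mapsto Q(x+te)$ is a polynomial of degree $<r$ in $t\in\mathbb{R}$. Theorem. There are constants $C(p,r)$ ($0<p\le\infty$, $r\in\mathbb{N}$), depending only on $p$ and $r$, such that for every convex body $G\subset\mathbb{R}^2$ there exist two linearly independent unit vectors $\xi_1,\xi_2\in\mathbb{R}^2$ such that for all $r\in\mathbb{N}$, all $0<p\le\infty$ and all $f\in L^p(G)$, $$E_{r-1}(f;\{\xi_1,\xi_2\})_{L^p(G)}\le C(p,r)\,\omega^r(f,G;\{\xi_1,\xi_2\})_p .$$ -/

import Mathlib

open scoped ENNReal NNReal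

namespace DirectionalWhitney

/-- The finite difference `Δ_ξ^r f (η) = ∑_{j=0}^r (-1)^{r+j} (r choose j) f (η + j ξ)`. -/
def finDiff {d : ℕ} (r : ℕ) (ξ : EuclideanSpace ℝ (Fin d)) (f : EuclideanSpace ℝ (Fin d) → ℝ)
    (η : EuclideanSpace ℝ (Fin d)) : ℝ :=
  ∑ j ∈ Finset.range (r + 1), (-1 : ℝ) ^ (r + j) * (r.choose j : ℝ) * f (η + (j : ℝ) • ξ)

/-- The finite difference relative to `Ω`: it is `Δ_ξ^r f (η)` if the segment `[η, η + r ξ]` is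
contained in `Ω`, and `0` otherwise. -/
noncomputable def finDiffOn {d : ℕ} (r : ℕ) (ξ : EuclideanSpace ℝ (Fin d))
    (f : EuclideanSpace ℝ (Fin d) → ℝ) (Ω : Set (EuclideanSpace ℝ (Fin d))) :
    EuclideanSpace ℝ (Fin d) → ℝ :=
  Set.indicator {η | segment ℝ η (η + (r : ℝ) • ξ) ⊆ Ω} (finDiff r ξ f)

/-- The (quasi-)norm on `L^p(Ω)`: the usual one for Lebesgue measure if `0 < p < ∞`, and the
uniform norm on `Ω` if `p = ∞`. -/
noncomputable def pNorm {d : ℕ} (p : ℝ≥0∞) (Ω : Set (EuclideanSpace ℝ (Fin d)))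
    (g : EuclideanSpace ℝ (Fin d) → ℝ) : ℝ≥0∞ :=
  if p = ∞ then ⨆ x ∈ Ω, ‖g x‖ₑ else MeasureTheory.eLpNorm g p (MeasureTheory.volume.restrict Ω)

/-- Membership in `L^p(Ω)`, with the convention `L^∞(Ω) = C(Ω)`. Only the values of `g` on `Ω`
matter. -/
def MemSpace {d : ℕ} (p : ℝ≥0∞) (Ω : Set (EuclideanSpace ℝ (Fin d)))
    (g : EuclideanSpace ℝ (Fin d) → ℝ) : Prop :=
  if p = ∞ then ContinuousOn g Ω else MeasureTheory.MemLp g p (MeasureTheory.volume.restrict Ω)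

/-- The directional modulus of smoothness `ω^r(f, t; 𝓔)_p` on `Ω`. -/
noncomputable def dirModulusAt {d : ℕ} (r : ℕ) (f : EuclideanSpace ℝ (Fin d) → ℝ)
    (Ω : Set (EuclideanSpace ℝ (Fin d))) (t : ℝ) (E : Set (EuclideanSpace ℝ (Fin d)))
    (p : ℝ≥0∞) : ℝ≥0∞ :=
  ⨆ ξ ∈ E, ⨆ u ∈ Set.Ioc (0 : ℝ) t, pNorm p Ω (finDiffOn r (u • ξ) f Ω)

/-- `ω^r(f, Ω; 𝓔)_p = ω^r(f, diam Ω; 𝓔)_p`. -/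
noncomputable def dirModulus {d : ℕ} (r : ℕ) (f : EuclideanSpace ℝ (Fin d) → ℝ)
    (Ω : Set (EuclideanSpace ℝ (Fin d))) (E : Set (EuclideanSpace ℝ (Fin d)))
    (p : ℝ≥0∞) : ℝ≥0∞ :=
  dirModulusAt r f Ω (Metric.diam Ω) E p

/-- The space `Π_{r-1}(𝓔)` of the algebraic polynomials `Q` whose restriction `t ↦ Q (x + t e)` to
every line with direction `e ∈ 𝓔` is a polynomial of degree `< r`. -/
def dirPoly (d r : ℕ) (E : Set (EuclideanSpace ℝ (Fin d))) : Set (MvPolynomial (Fin d) ℝ) :=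
  {Q | ∀ x : EuclideanSpace ℝ (Fin d), ∀ e ∈ E, ∃ q : Polynomial ℝ, q.degree < r ∧
    ∀ t : ℝ, MvPolynomial.eval (x + t • e).ofLp Q = q.eval t}

/-- The error of best approximation `E_{r-1}(f; 𝓔)_{L^p(Ω)}` by elements of `Π_{r-1}(𝓔)`. -/
noncomputable def dirError {d : ℕ} (r : ℕ) (f : EuclideanSpace ℝ (Fin d) → ℝ)
    (E : Set (EuclideanSpace ℝ (Fin d))) (p : ℝ≥0∞) (Ω : Set (EuclideanSpace ℝ (Fin d))) : ℝ≥0∞ :=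
  ⨅ Q ∈ dirPoly d r E, pNorm p Ω (fun x => f x - MvPolynomial.eval x.ofLp Q)

end DirectionalWhitney

/-! Take two chords PR and QS of G that maximise the determinant of their direction vectors. By
maximality the chords cross, and G lies in the parallelogram through their endpoints with sides
parallel to them. Use affine coordinates with origin at the crossing point and axes along the
chords, with the longer half of each chord scaled to length R. In these coordinates G is a compact
convex K in [-R, R]² that contains (R, 0), (0, R) and the projections of each of its points to both
axes (`exists_crossing_chords`, `isCrossBody_preimage`). The directions depend on G alone, whereas R
may still be chosen from p and r. It remains to approximate by polynomials of degree < r in each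
coordinate.

On a square (`exists_poly_near`), consider the mixed differences of step 1 and order (i, j). They
are small when i = r or j = r. Going down through the pairs in lexicographic order, the difference
of order (a, b) has small first differences of step 1. By the Marchaud-type inequality `marchaud`
its first differences are then small for every step, so it is close to a constant
(`exists_const_near`), and subtracting a multiple of x^a y^b removes that constant. At (0, 0) the
function itself is small. The Marchaud argument takes the supremum over steps u in [0, 1]: 2^k Δ_u^k
equals Δ_{2u}^k up to differences of higher order, and near periodicity brings 2u back to [0, 1].

From the square the bound spreads to K (`exists_lpMod_strip_le`, `exists_lpMod_crossBody_le`): a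
small r-th difference controls a value by r values further along the line, and a bounded number of
such extensions along the axes covers K.

All estimates use the power min(1, p) of the quasi-norm, which is subadditive for every p. They hold
for every Haar measure on the plane, so the affine change of variables leaves no trace of G in the
constants. -/

open scoped Pointwise

namespace DirectionalWhitney

open MeasureTheory Set

/-! ### Subadditive powers of the L^p quasi-norm -/

section LpMod

variable {α : Type*} [MeasurableSpace α]

/-- The `L^p` quasi-norm of `F` over `A`, with the supremum norm for `p = ∞`. -/
noncomputable def lpOn (p : ℝ≥0∞) (μ : Measure α) (A : Set α) (F : α → ℝ) : ℝ≥0∞ :=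
  if p = ∞ then ⨆ x ∈ A, ‖F x‖ₑ else eLpNorm F p (μ.restrict A)

/-- The exponent `min 1 p`, for which the power of the `L^p` quasi-norm is subadditive. -/
noncomputable def subExp (p : ℝ≥0∞) : ℝ := (min 1 p).toReal

/-- The subadditive power of the `L^p` quasi-norm. -/
noncomputable def lpMod (p : ℝ≥0∞) (μ : Measure α) (A : Set α) (F : α → ℝ) : ℝ≥0∞ :=
  lpOn p μ A F ^ subExp p

variable {p : ℝ≥0∞} {μ : Measure α} {A B : Set α} {F G : α → ℝ}

lemma subExp_pos (hp : 0 < p) : 0 < subExp p := by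
  refine ENNReal.toReal_pos ?_ ?_
  · simp [hp.ne']
  · exact ne_top_of_le_ne_top ENNReal.one_ne_top (min_le_left _ _)

lemma lpMod_eq_indicator (hA : MeasurableSet A) :
    lpMod p μ A F = lpMod p μ univ (A.indicator F) := by
  unfold lpMod lpOn
  split_ifs with h
  · congr 1
    apply le_antisymm
    · refine iSup₂_le fun x hx => ?_
      refine le_trans ?_ (le_iSup₂ (f := fun x (_ : x ∈ univ) => ‖A.indicator F x‖ₑ) x (mem_univ x))
      simp [hx]
    · refine iSup₂_le fun x _ => ?_
      by_cases hx : x ∈ A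
      · simpa [hx] using (le_iSup₂ (f := fun x (_ : x ∈ A) => ‖F x‖ₑ) x hx)
      · simp [hx]
  · rw [Measure.restrict_univ, eLpNorm_indicator_eq_eLpNorm_restrict hA]

lemma lpMod_congr (hA : MeasurableSet A) (h : ∀ x ∈ A, F x = G x) :
    lpMod p μ A F = lpMod p μ A G := by
  rw [lpMod_eq_indicator hA, lpMod_eq_indicator hA, indicator_congr h]

lemma lpMod_mono (h : A ⊆ B) : lpMod p μ A F ≤ lpMod p μ B F := by
  unfold lpMod lpOn
  refine ENNReal.rpow_le_rpow ?_ ENNReal.toReal_nonneg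
  split_ifs with hp
  · exact biSup_mono h
  · exact eLpNorm_mono_measure _ (Measure.restrict_mono h le_rfl)

/-- For p < 1 the p-th power turns the quasi-norm into an integral, and (s + t)^p ≤ s^p + t^p holds
pointwise. -/
lemma eLpNorm_rpow_add_le (hp1 : p < 1) (hF : Measurable F) :
    eLpNorm (fun x => F x + G x) p μ ^ p.toReal ≤
      eLpNorm F p μ ^ p.toReal + eLpNorm G p μ ^ p.toReal := by
  rcases eq_or_ne p 0 with rfl | h0
  · simp
  have ht : p ≠ ∞ := (hp1.trans ENNReal.one_lt_top).ne
  have hpos : p.toReal ≠ 0 := (ENNReal.toReal_pos h0 ht).ne'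
  have hle : p.toReal ≤ 1 := by
    simpa using ENNReal.toReal_mono ENNReal.one_ne_top hp1.le
  have key : ∀ H : α → ℝ, eLpNorm H p μ ^ p.toReal = ∫⁻ x, ‖H x‖ₑ ^ p.toReal ∂μ := by
    intro H
    rw [eLpNorm_eq_lintegral_rpow_enorm_toReal h0 ht, ← ENNReal.rpow_mul, one_div,
      inv_mul_cancel₀ hpos, ENNReal.rpow_one]
  rw [key, key, key, ← lintegral_add_left (hF.enorm.pow_const _)]
  refine lintegral_mono fun x => ?_
  exact (ENNReal.rpow_le_rpow (enorm_add_le _ _) ENNReal.toReal_nonneg).trans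
    (ENNReal.rpow_add_le_add_rpow _ _ ENNReal.toReal_nonneg hle)

lemma lpMod_add_le (hF : Measurable F) (hG : Measurable G) :
    lpMod p μ A (fun x => F x + G x) ≤ lpMod p μ A F + lpMod p μ A G := by
  unfold lpMod lpOn subExp
  split_ifs with h
  · simp only [h, le_top, inf_of_le_left, ENNReal.toReal_one, ENNReal.rpow_one]
    refine iSup₂_le fun x hx => (enorm_add_le _ _).trans ?_
    exact add_le_add (le_iSup₂ (f := fun x (_ : x ∈ A) => ‖F x‖ₑ) x hx)
      (le_iSup₂ (f := fun x (_ : x ∈ A) => ‖G x‖ₑ) x hx)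
  · rcases le_or_gt 1 p with h1 | h1
    · simp only [min_eq_left h1, ENNReal.toReal_one, ENNReal.rpow_one]
      exact eLpNorm_add_le hF.aestronglyMeasurable hG.aestronglyMeasurable h1
    · rw [min_eq_right h1.le]
      exact eLpNorm_rpow_add_le h1 hF

lemma lpMod_const_mul (c : ℝ) :
    lpMod p μ A (fun x => c * F x) = ‖c‖ₑ ^ subExp p * lpMod p μ A F := by
  have : lpOn p μ A (fun x => c * F x) = ‖c‖ₑ * lpOn p μ A F := by
    unfold lpOn
    split_ifs with h
    · simp only [enorm_mul, ENNReal.mul_iSup]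
    · exact eLpNorm_const_smul c F p _
  rw [lpMod, this, lpMod]
  exact ENNReal.mul_rpow_of_nonneg _ _ ENNReal.toReal_nonneg

lemma lpMod_neg : lpMod p μ A (fun x => - F x) = lpMod p μ A F := by
  have := lpMod_const_mul (p := p) (μ := μ) (A := A) (F := F) (-1)
  simpa using this

lemma lpMod_sub_le (hF : Measurable F) (hG : Measurable G) :
    lpMod p μ A (fun x => F x - G x) ≤ lpMod p μ A F + lpMod p μ A G := by
  rw [← lpMod_neg (F := G)]
  simpa only [sub_eq_add_neg] using lpMod_add_le (G := fun x => - G x) hF hG.neg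

lemma lpMod_zero (hp : 0 < p) : lpMod p μ A (fun _ => 0) = 0 := by
  unfold lpMod lpOn
  split_ifs <;> simp [subExp_pos hp]

lemma lpMod_empty (hp : 0 < p) : lpMod p μ ∅ F = 0 := by
  rw [lpMod_congr (G := fun _ => 0) MeasurableSet.empty (by simp), lpMod_zero hp]

lemma lpMod_sum_le (hp : 0 < p) {ι : Type*} (s : Finset ι) (f : ι → α → ℝ)
    (hf : ∀ i ∈ s, Measurable (f i)) :
    lpMod p μ A (fun x => ∑ i ∈ s, f i x) ≤ ∑ i ∈ s, lpMod p μ A (f i) := by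
  classical
  induction s using Finset.induction_on with
  | empty => simp [lpMod_zero hp]
  | insert i s his ih =>
    simp only [Finset.sum_insert his]
    have hm : ∀ j ∈ s, Measurable (f j) := fun j hj => hf j (Finset.mem_insert_of_mem hj)
    exact (lpMod_add_le (hf i (Finset.mem_insert_self _ _))
      (Finset.measurable_sum s hm)).trans (add_le_add le_rfl (ih hm))

lemma lpMod_union_le (hA : MeasurableSet A) (hB : MeasurableSet B) (hF : Measurable F) :
    lpMod p μ (A ∪ B) F ≤ lpMod p μ A F + lpMod p μ B F := by
  rw [lpMod_eq_indicator (hA.union hB), lpMod_eq_indicator hA]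
  have h1 : (A ∪ B).indicator F = fun x => A.indicator F x + (B \ A).indicator F x := by
    ext x
    by_cases h : x ∈ A <;> by_cases h' : x ∈ B <;> simp [h, h']
  rw [h1]
  refine (lpMod_add_le (hF.indicator hA) (hF.indicator (hB.diff hA))).trans ?_
  rw [← lpMod_eq_indicator (hB.diff hA)]
  exact add_le_add le_rfl (lpMod_mono sdiff_subset)

end LpMod

/-! ### Translation invariance -/

section Shift

variable {V : Type*} [AddCommGroup V] [MeasurableSpace V] [MeasurableAdd₂ V]
  {μ : Measure V} [μ.IsAddLeftInvariant] {p : ℝ≥0∞} {A B : Set V} {F : V → ℝ}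

lemma lpMod_shift_le (hB : MeasurableSet B) (hF : Measurable F) (v : V)
    (h : ∀ a ∈ A, a + v ∈ B) : lpMod p μ A (fun z => F (z + v)) ≤ lpMod p μ B F := by
  have hsub : A ⊆ (fun z => z + v) ⁻¹' B := h
  refine (lpMod_mono hsub).trans ?_
  unfold lpMod lpOn
  refine ENNReal.rpow_le_rpow ?_ ENNReal.toReal_nonneg
  split_ifs with hp
  · refine iSup₂_le fun x hx => ?_
    exact le_iSup₂ (f := fun x (_ : x ∈ B) => ‖F x‖ₑ) (x + v) hx
  · have hm := (measurePreserving_add_right μ v).restrict_preimage hB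
    exact (eLpNorm_comp_measurePreserving hF.aestronglyMeasurable hm).le

end Shift

/-! ### Finite differences and their norms -/

section Differences

lemma fwdDiff_comm {M : Type*} [AddCommGroup M] (a b : M) (F : M → ℝ) :
    fwdDiff a (fwdDiff b F) = fwdDiff b (fwdDiff a F) := by
  funext x
  simp only [fwdDiff, add_right_comm x b a]
  ring

lemma fwdDiff_iter_comm {M : Type*} [AddCommGroup M] (a b : M) (i j : ℕ) (F : M → ℝ) :
    (fwdDiff a)^[i] ((fwdDiff b)^[j] F) = (fwdDiff b)^[j] ((fwdDiff a)^[i] F) :=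
  Function.Commute.iterate_iterate (f := fwdDiff a) (g := fwdDiff b)
    (fun F => fwdDiff_comm a b F) i j F

/-- With T the translation by h, T² - 1 = (T - 1)² + 2 (T - 1), and the binomial theorem applies.
The term i = 0 is 2^k Δ_h^k, while all others have order above k; this gap drives the Marchaud
argument. -/
lemma fwdDiff_iter_two_nsmul {M : Type*} [AddCommGroup M] (h : M) (k : ℕ) (F : M → ℝ) (x : M) :
    (fwdDiff (h + h))^[k] F x =
      ∑ i ∈ Finset.range (k + 1), ((k.choose i : ℝ) * 2 ^ (k - i)) * (fwdDiff h)^[k + i] F x := by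
  have h2 : fwdDiff_aux.fwdDiffₗ M ℝ (h + h) =
      fwdDiff_aux.fwdDiffₗ M ℝ h ^ 2 + (2 : ℤ) • fwdDiff_aux.fwdDiffₗ M ℝ h := by
    ext F x
    simp only [pow_two, two_smul, LinearMap.add_apply, Module.End.mul_apply, Pi.add_apply,
      fwdDiff_aux.fwdDiffₗ_apply, fwdDiff, ← add_assoc]
    ring
  have hc : Commute (fwdDiff_aux.fwdDiffₗ M ℝ h ^ 2) ((2 : ℤ) • fwdDiff_aux.fwdDiffₗ M ℝ h) :=
    ((Commute.refl _).pow_left 2).smul_right 2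
  rw [← fwdDiff_aux.coe_fwdDiffₗ_pow, h2, hc.add_pow, LinearMap.sum_apply, Finset.sum_apply]
  refine Finset.sum_congr rfl fun i hi => ?_
  have hik : 2 * i + (k - i) = k + i := by
    have := Finset.mem_range.1 hi
    omega
  rw [← nsmul_eq_mul', smul_pow, mul_smul_comm, ← pow_mul, ← pow_add, hik, LinearMap.smul_apply,
    LinearMap.smul_apply, ← fwdDiff_aux.coe_fwdDiffₗ_pow, Pi.smul_apply, Pi.smul_apply]
  simp [mul_assoc]

variable {V : Type*} [AddCommGroup V] [MeasurableSpace V] [MeasurableAdd₂ V]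
  {μ : Measure V} [μ.IsAddLeftInvariant] {p : ℝ≥0∞} {A B : Set V} {F : V → ℝ}

lemma measurable_fwdDiff (h : V) (hF : Measurable F) : Measurable (fwdDiff h F) :=
  (hF.comp (measurable_id.add_const h)).sub hF

lemma measurable_fwdDiff_iter (h : V) (k : ℕ) (hF : Measurable F) :
    Measurable ((fwdDiff h)^[k] F) := by
  induction k with
  | zero => exact hF
  | succ k ih =>
    rw [Function.iterate_succ_apply']
    exact measurable_fwdDiff h ih

lemma lpMod_fwdDiff_le (hB : MeasurableSet B) (hF : Measurable F) (h : V)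
    (hA : ∀ a ∈ A, a ∈ B ∧ a + h ∈ B) : lpMod p μ A (fwdDiff h F) ≤ 2 * lpMod p μ B F := by
  rw [two_mul]
  refine (lpMod_sub_le (hF.comp (measurable_id.add_const h)) hF).trans (add_le_add ?_ ?_)
  · exact lpMod_shift_le hB hF h fun a ha => (hA a ha).2
  · exact lpMod_mono fun a ha => (hA a ha).1

lemma lpMod_fwdDiff_iter_le (hB : MeasurableSet B) (hF : Measurable F) (h : V) (k : ℕ)
    (hA : ∀ a ∈ A, ∀ j ≤ k, a + j • h ∈ B) :
    lpMod p μ A ((fwdDiff h)^[k] F) ≤ 2 ^ k * lpMod p μ B F := by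
  induction k generalizing F B with
  | zero => simpa using lpMod_mono fun a ha => by simpa using hA a ha 0 le_rfl
  | succ k ih =>
    have hB' : MeasurableSet (B ∩ (fun z => z + h) ⁻¹' B) :=
      hB.inter (measurable_id.add_const h hB)
    rw [Function.iterate_succ_apply]
    refine (ih hB' (measurable_fwdDiff h hF) fun a ha j hj => ⟨hA a ha j (by omega), ?_⟩).trans ?_
    · have := hA a ha (j + 1) (by omega)
      rwa [succ_nsmul, ← add_assoc] at this
    · rw [pow_succ, mul_assoc]
      gcongr
      exact lpMod_fwdDiff_le hB hF h fun a ha => ha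

/-- Iterating Δ_{a+b} F = Δ_a F + (Δ_b F)(· + a) trades the step a + b for a at the price of Δ_b F.
Each translation by a or b uses up one level of the chain `D`, so two levels go per iteration. -/
lemma lpMod_fwdDiff_iter_add_le {η : ℝ≥0∞} (D : ℕ → Set V) (hD : ∀ i, MeasurableSet (D i))
    (a b : V) (hDD : ∀ i, D i ⊆ D (i + 1)) (hDa : ∀ i, ∀ x ∈ D i, x + a ∈ D (i + 1))
    (hDb : ∀ i, ∀ x ∈ D i, x + b ∈ D (i + 1)) (hF : Measurable F) (k : ℕ)
    (h : lpMod p μ (D (2 * k)) (fwdDiff b F) ≤ η) :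
    lpMod p μ (D 0) ((fwdDiff (a + b))^[k] F) ≤ lpMod p μ (D 0) ((fwdDiff a)^[k] F) + 4 ^ k * η := by
  have hmono : Monotone D := monotone_nat_of_le_succ hDD
  induction k generalizing F η with
  | zero => simp
  | succ k ih =>
    have hsplit : fwdDiff (a + b) F = fun x => fwdDiff a F x + fwdDiff b F (x + a) := by
      funext x
      simp only [fwdDiff, add_assoc]
      ring
    have hm : Measurable fun x => fwdDiff b F (x + a) :=
      (measurable_fwdDiff b hF).comp (measurable_id.add_const a)
    have hiter : (fwdDiff (a + b))^[k + 1] F = fun x => (fwdDiff (a + b))^[k] (fwdDiff a F) x +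
        (fwdDiff (a + b))^[k] (fun x => fwdDiff b F (x + a)) x := by
      rw [Function.iterate_succ_apply, hsplit]
      exact fwdDiff_iter_add (a + b) (fwdDiff a F) (fun x => fwdDiff b F (x + a)) k
    rw [hiter]
    refine (lpMod_add_le (measurable_fwdDiff_iter _ _ (measurable_fwdDiff a hF))
      (measurable_fwdDiff_iter _ _ hm)).trans ?_
    have h1 : lpMod p μ (D (2 * k)) (fwdDiff b (fwdDiff a F)) ≤ 2 * η := by
      rw [fwdDiff_comm]
      refine (lpMod_fwdDiff_le (hD (2 * k + 1)) (measurable_fwdDiff b hF) a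
        fun x hx => ⟨hDD _ hx, hDa _ x hx⟩).trans ?_
      gcongr
      exact (lpMod_mono (hmono (by omega))).trans h
    have hmem : ∀ j : ℕ, ∀ x ∈ D 0, x + j • (a + b) ∈ D (2 * j) := by
      intro j x hx
      induction j with
      | zero => simpa using hx
      | succ j ihj =>
        have := hDb _ _ (hDa _ _ ihj)
        rw [succ_nsmul, show x + (j • (a + b) + (a + b)) = x + j • (a + b) + a + b by abel]
        exact this
    have h2 : lpMod p μ (D 0) ((fwdDiff (a + b))^[k] (fun x => fwdDiff b F (x + a))) ≤
        2 ^ k * η := by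
      refine (lpMod_fwdDiff_iter_le (hD (2 * k)) hm (a + b) k
        fun x hx j hj => hmono (by omega) (hmem j x hx)).trans ?_
      gcongr
      exact (lpMod_shift_le (hD (2 * (k + 1))) (measurable_fwdDiff b hF) a
        fun x hx => hmono (by omega) (hDa _ x hx)).trans h
    refine (add_le_add (ih (measurable_fwdDiff a hF) h1) h2).trans ?_
    rw [add_assoc, Function.iterate_succ_apply]
    refine add_le_add le_rfl ?_
    rw [← mul_assoc, ← add_mul]
    gcongr
    have : (2 : ℝ≥0∞) ^ k ≤ 4 ^ k := by gcongr; norm_num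
    calc (4 : ℝ≥0∞) ^ k * 2 + 2 ^ k ≤ 4 ^ k * 2 + 4 ^ k * 2 := by
          gcongr
          exact this.trans (le_mul_of_one_le_right' one_le_two)
      _ = 4 ^ (k + 1) := by rw [← mul_add, pow_succ]; norm_num

/-- Absorption: subtract θ and divide by q - 1. The subtraction is legitimate only because θ is
finite. -/
lemma le_of_mul_le_add {q C : ℝ≥0} {θ η : ℝ≥0∞} (hq : 1 < q) (hC : 0 < C) (hθ : θ ≠ ∞)
    (h : q * θ ≤ θ + C * η) : θ ≤ (C / (q - 1) : ℝ≥0) * η := by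
  have hq1 : 0 < q - 1 := tsub_pos_of_lt hq
  rcases eq_or_ne η ∞ with rfl | hη
  · rw [ENNReal.mul_top (by simpa using (div_pos hC hq1).ne')]
    exact le_top
  lift θ to ℝ≥0 using hθ
  lift η to ℝ≥0 using hη
  norm_cast at h ⊢
  rw [div_mul_eq_mul_div, le_div_iff₀ hq1]
  rw [← NNReal.coe_le_coe] at h ⊢
  push_cast [NNReal.coe_sub hq.le] at h ⊢
  linarith

end Differences

/-! ### A Marchaud inequality for nearly periodic functions -/

section Marchaud

/-- The square `[0, L]²`. -/
def box (L : ℝ) : Set (ℝ × ℝ) := Icc 0 L ×ˢ Icc 0 L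

lemma mem_box {L : ℝ} {z : ℝ × ℝ} :
    z ∈ box L ↔ (0 ≤ z.1 ∧ z.1 ≤ L) ∧ 0 ≤ z.2 ∧ z.2 ≤ L := Iff.rfl

lemma measurableSet_box (L : ℝ) : MeasurableSet (box L) := measurableSet_Icc.prod measurableSet_Icc

lemma box_mono {L M : ℝ} (h : L ≤ M) : box L ⊆ box M :=
  prod_mono (Icc_subset_Icc le_rfl h) (Icc_subset_Icc le_rfl h)

/-- The vectors with both coordinates in `[0, 1]`. -/
def IsStep (e : ℝ × ℝ) : Prop := (0 ≤ e.1 ∧ e.1 ≤ 1) ∧ 0 ≤ e.2 ∧ e.2 ≤ 1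

lemma IsStep.smul {e : ℝ × ℝ} (he : IsStep e) {u : ℝ} (hu : u ∈ Icc (0 : ℝ) 1) :
    IsStep (u • e) := by
  obtain ⟨⟨h1, h2⟩, h3, h4⟩ := he
  obtain ⟨h5, h6⟩ := hu
  refine ⟨⟨mul_nonneg h5 h1, ?_⟩, mul_nonneg h5 h3, ?_⟩ <;>
  simpa using mul_le_one₀ h6 ‹_› ‹_›

lemma IsStep.add_mem_box {e : ℝ × ℝ} (he : IsStep e) {L : ℝ} {z : ℝ × ℝ} (hz : z ∈ box L) :
    z + e ∈ box (L + 1) := by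
  obtain ⟨⟨h1, h2⟩, h3, h4⟩ := he
  obtain ⟨⟨h5, h6⟩, h7, h8⟩ := mem_box.1 hz
  refine mem_box.2 ⟨⟨?_, ?_⟩, ?_, ?_⟩ <;> simp <;> linarith

lemma IsStep.add_nsmul_mem_box {e : ℝ × ℝ} (he : IsStep e) {L : ℝ} {z : ℝ × ℝ} (hz : z ∈ box L)
    (j : ℕ) : z + j • e ∈ box (L + j) := by
  induction j with
  | zero => simpa using hz
  | succ j ih =>
    rw [succ_nsmul, ← add_assoc, Nat.cast_succ, ← add_assoc]
    exact he.add_mem_box ih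

variable {p : ℝ≥0∞}

lemma lpMod_fwdDiff_iter_box_le {μ : Measure (ℝ × ℝ)} [μ.IsAddLeftInvariant] {e : ℝ × ℝ}
    (he : IsStep e) {G : ℝ × ℝ → ℝ} (hG : Measurable G) (L : ℝ) (k : ℕ) :
    lpMod p μ (box L) ((fwdDiff e)^[k] G) ≤ 2 ^ k * lpMod p μ (box (L + k)) G := by
  refine lpMod_fwdDiff_iter_le (measurableSet_box _) hG e k fun a ha j hj => ?_
  exact box_mono (by gcongr) (he.add_nsmul_mem_box ha j)

/-- Let θ be the supremum over u of the left side. The doubling identity bounds (2^k)^s θ, with s =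
`subExp p`, by the norm of Δ_{2u}^k plus the differences of orders k + 1, …, 2k, and the former is
at most θ + 4^k η. Since (2^k)^s > 1, θ can be absorbed. -/
lemma marchaud_step {μ : Measure (ℝ × ℝ)} [μ.IsAddLeftInvariant] (hp : 0 < p) {k : ℕ} (hk : 1 ≤ k)
    {e : ℝ × ℝ} (he : IsStep e) {G : ℝ × ℝ → ℝ} (hG : Measurable G) {L : ℝ}
    (hfin : lpMod p μ (box (L + k)) G ≠ ∞) {η : ℝ≥0∞}
    (hper : lpMod p μ (box (L + (2 * k : ℕ))) (fwdDiff e G) ≤ η) {C : ℕ → ℝ≥0}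
    (hhigh : ∀ i < k, ∀ u ∈ Icc (0 : ℝ) 1,
      lpMod p μ (box L) ((fwdDiff (u • e))^[k + (i + 1)] G) ≤ C i * η) :
    ∀ u ∈ Icc (0 : ℝ) 1, lpMod p μ (box L) ((fwdDiff (u • e))^[k] G) ≤
      ((4 ^ k + ∑ i ∈ Finset.range k,
        ‖(k.choose (i + 1) : ℝ) * 2 ^ (k - (i + 1))‖₊ ^ subExp p * C i) /
          (‖(2 : ℝ) ^ k‖₊ ^ subExp p - 1) : ℝ≥0) * η := by
  set θ : ℝ≥0∞ := ⨆ u ∈ Icc (0 : ℝ) 1, lpMod p μ (box L) ((fwdDiff (u • e))^[k] G) with hθ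
  have hle : ∀ u ∈ Icc (0 : ℝ) 1, lpMod p μ (box L) ((fwdDiff (u • e))^[k] G) ≤ θ :=
    fun u hu => le_iSup₂ (f := fun u (_ : u ∈ Icc (0 : ℝ) 1) =>
      lpMod p μ (box L) ((fwdDiff (u • e))^[k] G)) u hu
  -- This crude bound serves only to make the absorption legitimate.
  have hθfin : θ ≠ ∞ := by
    refine ne_top_of_le_ne_top (b := 2 ^ k * lpMod p μ (box (L + k)) G)
      (ENNReal.mul_ne_top (by simp) hfin) (iSup₂_le fun u hu => ?_)
    exact lpMod_fwdDiff_iter_box_le (he.smul hu) hG L k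
  have hdouble : ∀ u ∈ Icc (0 : ℝ) 1,
      lpMod p μ (box L) ((fwdDiff (u • e + u • e))^[k] G) ≤ θ + 4 ^ k * η := by
    intro u hu
    -- For u ≤ 1/2 the doubled step is still in [0, 1]. Otherwise 2u - 1 is, and the remaining full
    -- step e is cheap by near periodicity.
    rcases le_or_gt u (1 / 2) with h | h
    · rw [← add_smul]
      exact (hle _ ⟨by linarith [hu.1], by linarith⟩).trans le_self_add
    · have h' : (2 * u - 1) ∈ Icc (0 : ℝ) 1 := ⟨by linarith, by linarith [hu.2]⟩
      have : u • e + u • e = (2 * u - 1) • e + e := by module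
      rw [this]
      have := lpMod_fwdDiff_iter_add_le (p := p) (μ := μ) (η := η) (fun i => box (L + i))
        (fun i => measurableSet_box _) ((2 * u - 1) • e) e (fun i => box_mono (by simp))
        (fun i x hx => by
          simpa [add_assoc] using (he.smul h').add_mem_box hx)
        (fun i x hx => by simpa [add_assoc] using he.add_mem_box hx) hG k hper
      simp only [Nat.cast_zero, add_zero] at this
      exact this.trans (add_le_add (hle _ h') le_rfl)
  have hq : 1 < ‖(2 : ℝ) ^ k‖₊ ^ subExp p := by
    refine NNReal.one_lt_rpow ?_ (subExp_pos hp)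
    rw [nnnorm_pow]
    exact one_lt_pow₀ (by simp) (by omega)
  have hmain : ((‖(2 : ℝ) ^ k‖₊ ^ subExp p : ℝ≥0) : ℝ≥0∞) * θ ≤ θ + ((4 ^ k + ∑ i ∈ Finset.range k,
        ‖(k.choose (i + 1) : ℝ) * 2 ^ (k - (i + 1))‖₊ ^ subExp p * C i : ℝ≥0) : ℝ≥0∞) * η := by
    rw [hθ, ENNReal.mul_iSup]
    refine iSup_le fun u => ?_
    rw [ENNReal.mul_iSup]
    refine iSup_le fun hu => ?_
    rw [← hθ]
    have hsum : ∀ c : ℝ, ((‖c‖₊ ^ subExp p : ℝ≥0) : ℝ≥0∞) = ‖c‖ₑ ^ subExp p := fun c => by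
      rw [ENNReal.coe_rpow_of_nonneg _ (subExp_pos hp).le, enorm_eq_nnnorm]
    rw [hsum, ← lpMod_const_mul]
    have hid : (fun x => (2 : ℝ) ^ k * (fwdDiff (u • e))^[k] G x) = fun x =>
        (fwdDiff (u • e + u • e))^[k] G x - ∑ i ∈ Finset.range k,
          ((k.choose (i + 1) : ℝ) * 2 ^ (k - (i + 1))) * (fwdDiff (u • e))^[k + (i + 1)] G x := by
      funext x
      rw [fwdDiff_iter_two_nsmul, Finset.sum_range_succ']
      simp
    have hmeas : ∀ i, Measurable fun x =>
        ((k.choose (i + 1) : ℝ) * 2 ^ (k - (i + 1))) * (fwdDiff (u • e))^[k + (i + 1)] G x :=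
      fun i => (measurable_fwdDiff_iter _ _ hG).const_mul _
    rw [hid]
    refine (lpMod_sub_le (measurable_fwdDiff_iter _ _ hG)
      (Finset.measurable_sum _ fun i _ => hmeas i)).trans ?_
    push_cast
    rw [add_mul, ← add_assoc, Finset.sum_mul]
    refine add_le_add (hdouble u hu) ((lpMod_sum_le hp _ _ fun i _ => hmeas i).trans ?_)
    refine Finset.sum_le_sum fun i hi => ?_
    rw [lpMod_const_mul, hsum, mul_assoc]
    gcongr
    exact hhigh i (Finset.mem_range.1 hi) u hu
  intro u hu
  refine (hle u hu).trans (le_of_mul_le_add hq (by positivity) hθfin hmain)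

/-- A Marchaud-type inequality for functions that are nearly periodic in the direction `e`. -/
lemma marchaud (hp : 0 < p) (r : ℕ) (n k : ℕ) (hk : 1 ≤ k) (hrk : r ≤ k + n) :
    ∃ C : ℝ≥0, ∃ m : ℕ, ∀ (μ : Measure (ℝ × ℝ)) [μ.IsAddLeftInvariant] (e : ℝ × ℝ), IsStep e →
      ∀ G : ℝ × ℝ → ℝ, Measurable G → (∀ L, lpMod p μ (box L) G ≠ ∞) → ∀ (L : ℝ) (η : ℝ≥0∞),
        lpMod p μ (box (L + m)) (fwdDiff e G) ≤ η →
        (∀ u ∈ Icc (0 : ℝ) 1, lpMod p μ (box (L + m)) ((fwdDiff (u • e))^[r] G) ≤ η) →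
        ∀ u ∈ Icc (0 : ℝ) 1, lpMod p μ (box L) ((fwdDiff (u • e))^[k] G) ≤ C * η := by
  -- A downward induction on the order k, with n bounding r - k. At n = 0 the order is at least r,
  -- and every order k + (i + 1) needed for k falls under a smaller n.
  induction n generalizing k with
  | zero =>
    refine ⟨2 ^ (k - r), k - r, fun μ _ e he G hG hfin L η _ h u hu => ?_⟩
    have : k = (k - r) + r := by omega
    conv_lhs => rw [this, Function.iterate_add_apply]
    refine (lpMod_fwdDiff_iter_box_le (he.smul hu) (measurable_fwdDiff_iter _ _ hG) L _).trans ?_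
    push_cast
    gcongr
    exact h u hu
  | succ n ih =>
    choose C m hCm using fun i => ih (k + (i + 1)) (by omega) (by omega)
    refine ⟨(4 ^ k + ∑ i ∈ Finset.range k,
      ‖(k.choose (i + 1) : ℝ) * 2 ^ (k - (i + 1))‖₊ ^ subExp p * C i) /
        (‖(2 : ℝ) ^ k‖₊ ^ subExp p - 1), 2 * k + ∑ i ∈ Finset.range k, m i, ?_⟩
    intro μ _ e he G hG hfin L η hper hr
    have hle : ∀ i < k, m i ≤ 2 * k + ∑ i ∈ Finset.range k, m i := fun i hi =>
      (Finset.single_le_sum (f := m) (fun _ _ => Nat.zero_le _) (Finset.mem_range.2 hi)).trans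
        (Nat.le_add_left _ _)
    refine marchaud_step hp hk he hG (hfin _) ((lpMod_mono (box_mono ?_)).trans hper) ?_
    · gcongr
      omega
    · intro i hi
      have hbox : box (L + m i) ⊆ box (L + (2 * k + ∑ i ∈ Finset.range k, m i : ℕ)) := by
        refine box_mono ?_
        gcongr
        exact hle i hi
      exact hCm i μ e he G hG hfin L η ((lpMod_mono hbox).trans hper)
        fun u hu => (lpMod_mono hbox).trans (hr u hu)

end Marchaud

/-! ### Small differences imply closeness to a constant -/

section Averaging

variable {p : ℝ≥0∞}

lemma measure_symm_box_le (μ : Measure (ℝ × ℝ)) [μ.IsAddHaarMeasure] (L : ℝ) :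
    μ (Icc (-L) L ×ˢ Icc (-L) L) ≤ 4 * μ (box L) := by
  have h1 : (fun z : ℝ × ℝ => z + (-L, -L)) ⁻¹' (Icc (-L) L ×ˢ Icc (-L) L) ⊆
      (2 : ℝ) • box L := by
    rintro ⟨a, b⟩ ⟨⟨h1, h2⟩, h3, h4⟩
    simp only [Prod.mk_add_mk] at h1 h2 h3 h4
    refine ⟨(a / 2, b / 2), mem_box.2 ⟨⟨?_, ?_⟩, ?_, ?_⟩, ?_⟩
    · dsimp only; linarith
    · dsimp only; linarith
    · dsimp only; linarith
    · dsimp only; linarith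
    · ext <;> simp <;> ring
  rw [← measure_preimage_add_right μ (-L, -L)]
  refine (measure_mono h1).trans ?_
  rw [Measure.addHaar_smul]
  have : Module.finrank ℝ (ℝ × ℝ) = 2 := by simp
  rw [this]
  norm_num

lemma measure_box_ne_top (μ : Measure (ℝ × ℝ)) [μ.IsAddHaarMeasure] (L : ℝ) : μ (box L) ≠ ∞ :=
  (isCompact_Icc.prod isCompact_Icc).measure_lt_top.ne

lemma measure_box_ne_zero (μ : Measure (ℝ × ℝ)) [μ.IsAddHaarMeasure] {L : ℝ} (hL : 0 < L) :
    μ (box L) ≠ 0 := by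
  refine (Measure.measure_pos_of_nonempty_interior μ ⟨(L / 2, L / 2), ?_⟩).ne'
  rw [box, interior_prod_eq, interior_Icc]
  exact ⟨⟨by linarith, by linarith⟩, by linarith, by linarith⟩

/-- The substitution y = x + v and Tonelli make this an integral over the shifts v, which range over
a square of at most four times the measure of the box. -/
lemma lintegral_box_shift_le (μ : Measure (ℝ × ℝ)) [μ.IsAddHaarMeasure] {L : ℝ}
    {g : ℝ × ℝ → ℝ × ℝ → ℝ≥0∞} (hg : Measurable (Function.uncurry g)) {M : ℝ≥0∞}
    (h : ∀ v ∈ Icc (-L) L ×ˢ Icc (-L) L,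
      ∫⁻ x in {x | x ∈ box L ∧ x + v ∈ box L}, g x (x + v) ∂μ ≤ M) :
    ∫⁻ x in box L, ∫⁻ y in box L, g x y ∂μ ∂μ ≤ μ (box L) * (4 * M) := by
  set f : ℝ × ℝ → ℝ × ℝ → ℝ≥0∞ := fun x y => (box L ×ˢ box L).indicator (Function.uncurry g) (x, y)
    with hf
  have hfm : Measurable (Function.uncurry f) :=
    hg.indicator ((measurableSet_box L).prod (measurableSet_box L))
  have h1 : ∫⁻ x in box L, ∫⁻ y in box L, g x y ∂μ ∂μ = ∫⁻ x, ∫⁻ y, f x y ∂μ ∂μ := by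
    rw [← lintegral_indicator (measurableSet_box L)]
    congr 1
    funext x
    by_cases hx : x ∈ box L
    · rw [indicator_of_mem hx, ← lintegral_indicator (measurableSet_box L)]
      congr 1
      funext y
      by_cases hy : y ∈ box L <;> simp [hf, hx, hy]
    · simp [hf, hx]
  have hsh : Measurable (Function.uncurry fun x v => f x (x + v)) :=
    hfm.comp (measurable_fst.prodMk (measurable_fst.add measurable_snd))
  have h2 : ∫⁻ x, ∫⁻ y, f x y ∂μ ∂μ = ∫⁻ v, ∫⁻ x, f x (x + v) ∂μ ∂μ := by
    rw [← lintegral_lintegral_swap hsh.aemeasurable]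
    congr 1
    funext x
    exact (lintegral_add_left_eq_self (f x) x).symm
  rw [h1, h2]
  calc ∫⁻ v, ∫⁻ x, f x (x + v) ∂μ ∂μ
      ≤ ∫⁻ v, (Icc (-L) L ×ˢ Icc (-L) L).indicator (fun _ => M) v ∂μ := by
        refine lintegral_mono fun v => ?_
        by_cases hv : v ∈ Icc (-L) L ×ˢ Icc (-L) L
        · rw [indicator_of_mem hv]
          refine le_trans (le_of_eq ?_) (h v hv)
          have hm : MeasurableSet {x | x ∈ box L ∧ x + v ∈ box L} :=
            (measurableSet_box L).inter (measurable_id.add_const v (measurableSet_box L))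
          rw [← lintegral_indicator hm]
          congr 1
        · have : ∀ x, f x (x + v) = 0 := by
            intro x
            refine indicator_of_notMem (fun hx => hv ?_) _
            obtain ⟨⟨⟨a1, a2⟩, a3, a4⟩, ⟨b1, b2⟩, b3, b4⟩ := hx
            simp only [Prod.fst_add, Prod.snd_add] at a1 a2 a3 a4 b1 b2 b3 b4
            exact ⟨⟨by linarith, by linarith⟩, by linarith, by linarith⟩
          simp [this]
    _ = M * μ (Icc (-L) L ×ˢ Icc (-L) L) := by
        rw [lintegral_indicator_const (measurableSet_Icc.prod measurableSet_Icc)]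
    _ ≤ M * (4 * μ (box L)) := by
        gcongr
        exact measure_symm_box_le μ L
    _ = μ (box L) * (4 * M) := by ring

lemma lpMod_eq_lintegral {α : Type*} [MeasurableSpace α] {μ : Measure α} (hp : 0 < p) (ht : p ≠ ∞)
    (A : Set α) (F : α → ℝ) :
    lpMod p μ A F = (∫⁻ x in A, ‖F x‖ₑ ^ p.toReal ∂μ) ^ (subExp p / p.toReal) := by
  rw [lpMod, lpOn, if_neg ht, eLpNorm_eq_lintegral_rpow_enorm_toReal hp.ne' ht, ← ENNReal.rpow_mul]
  congr 1
  ring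

/-- For p < ∞ the mean over x of ∫ |G y - G x|^p dy is controlled by the shifts, so some x is no
worse than the mean and G x is the constant. For p = ∞ the value at the corner works. -/
lemma exists_lpMod_sub_const_le (hp : 0 < p) (μ : Measure (ℝ × ℝ)) [μ.IsAddHaarMeasure]
    {G : ℝ × ℝ → ℝ} (hG : Measurable G) {L : ℝ} (hL : 0 < L) {η : ℝ≥0∞}
    (h : ∀ v ∈ Icc (-L) L ×ˢ Icc (-L) L,
      lpMod p μ {x | x ∈ box L ∧ x + v ∈ box L} (fun x => G (x + v) - G x) ≤ η) :
    ∃ c : ℝ, lpMod p μ (box L) (fun x => G x - c) ≤ 4 * η := by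
  rcases eq_or_ne p ∞ with rfl | ht
  · have hs : subExp ∞ = 1 := by simp [subExp]
    refine ⟨G 0, ?_⟩
    simp only [lpMod, lpOn, if_true, hs, ENNReal.rpow_one] at h ⊢
    refine iSup₂_le fun x hx => ?_
    have h0 : (0 : ℝ × ℝ) ∈ box L := mem_box.2 ⟨⟨le_rfl, hL.le⟩, le_rfl, hL.le⟩
    have hx' : x ∈ Icc (-L) L ×ˢ Icc (-L) L := by
      obtain ⟨⟨a1, a2⟩, a3, a4⟩ := hx
      exact ⟨⟨by linarith, a2⟩, by linarith, a4⟩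
    have := (iSup₂_le_iff.1 (h x hx')) 0 ⟨h0, by simpa using hx⟩
    simp only [zero_add] at this
    exact this.trans (le_mul_of_one_le_left' (by norm_num))
  · have ht0 : 0 < p.toReal := ENNReal.toReal_pos hp.ne' ht
    have hs0 := subExp_pos hp
    have hsp : subExp p / p.toReal ≤ 1 := by
      rw [div_le_one ht0]
      exact ENNReal.toReal_mono ht (min_le_right _ _)
    simp only [lpMod_eq_lintegral hp ht] at h ⊢
    have hpow : ∀ a : ℝ≥0∞, a ^ (subExp p / p.toReal) ≤ η ↔ a ≤ η ^ (p.toReal / subExp p) := by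
      intro a
      rw [← inv_div (subExp p), ENNReal.le_rpow_inv_iff (by positivity)]
    have hg : Measurable (Function.uncurry fun x y : ℝ × ℝ => ‖G y - G x‖ₑ ^ p.toReal) :=
      ((hG.comp measurable_snd).sub (hG.comp measurable_fst)).enorm.pow_const _
    have key := lintegral_box_shift_le μ (L := L) (M := η ^ (p.toReal / subExp p)) hg
      fun v hv => (hpow _).1 (h v hv)
    have hIm : Measurable fun x : ℝ × ℝ => ∫⁻ y in box L, ‖G y - G x‖ₑ ^ p.toReal ∂μ :=
      hg.lintegral_prod_right'
    obtain ⟨x, hx, hxle⟩ := exists_le_setLAverage (measure_box_ne_zero μ hL)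
      (measure_box_ne_top μ L) hIm.aemeasurable
    refine ⟨G x, ?_⟩
    have hle : ∫⁻ y in box L, ‖G y - G x‖ₑ ^ p.toReal ∂μ ≤ 4 * η ^ (p.toReal / subExp p) := by
      refine hxle.trans ?_
      rw [setLAverage_eq]
      exact ENNReal.div_le_of_le_mul' key
    refine (ENNReal.rpow_le_rpow hle (by positivity)).trans ?_
    rw [ENNReal.mul_rpow_of_nonneg _ _ (by positivity), ← ENNReal.rpow_mul,
      show p.toReal / subExp p * (subExp p / p.toReal) = 1 by field_simp, ENNReal.rpow_one]
    gcongr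
    calc (4 : ℝ≥0∞) ^ (subExp p / p.toReal) ≤ 4 ^ (1 : ℝ) :=
          ENNReal.rpow_le_rpow_of_exponent_le (by norm_num) hsp
      _ = 4 := ENNReal.rpow_one _

lemma lpMod_fwdDiff_nsmul_le (hp : 0 < p) {μ : Measure (ℝ × ℝ)} [μ.IsAddLeftInvariant] {a : ℝ × ℝ}
    (ha : IsStep a) {G : ℝ × ℝ → ℝ} (hG : Measurable G) (L : ℝ) (n : ℕ) :
    lpMod p μ (box L) (fwdDiff (n • a) G) ≤ n * lpMod p μ (box (L + n)) (fwdDiff a G) := by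
  induction n with
  | zero =>
    have : fwdDiff ((0 : ℕ) • a) G = fun _ => 0 := by
      funext x
      simp [fwdDiff]
    rw [this, lpMod_zero hp]
    exact zero_le
  | succ n ih =>
    have : fwdDiff ((n + 1) • a) G = fun x => fwdDiff (n • a) G x + fwdDiff a G (x + n • a) := by
      funext x
      simp only [fwdDiff, succ_nsmul, add_assoc]
      ring
    rw [this]
    refine (lpMod_add_le (measurable_fwdDiff _ hG)
      ((measurable_fwdDiff _ hG).comp (measurable_id.add_const _))).trans ?_
    push_cast
    rw [add_mul, one_mul]
    refine add_le_add (ih.trans ?_) (lpMod_shift_le (measurableSet_box _) (measurable_fwdDiff a hG) _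
      fun x hx => box_mono (by linarith) (ha.add_nsmul_mem_box hx n))
    gcongr
    exact lpMod_mono (box_mono (by linarith))

lemma lpMod_shift_sub_le {μ : Measure (ℝ × ℝ)} [μ.IsAddLeftInvariant] {e : ℝ × ℝ}
    {G : ℝ × ℝ → ℝ} (hG : Measurable G) {L : ℝ} {η : ℝ≥0∞}
    (h : ∀ u ∈ Icc (0 : ℝ) L, lpMod p μ (box L) (fwdDiff (u • e) G) ≤ η) {w : ℝ}
    (hw : w ∈ Icc (-L) L) :
    lpMod p μ {x | x ∈ box L ∧ x + w • e ∈ box L} (fun x => G (x + w • e) - G x) ≤ η := by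
  rcases le_total 0 w with h0 | h0
  · exact (lpMod_mono fun x hx => hx.1).trans (h w ⟨h0, hw.2⟩)
  · have : (fun x => G (x + w • e) - G x) =
        fun x => - (fwdDiff ((-w) • e) G (x + w • e)) := by
      funext x
      simp [fwdDiff]
    rw [this, lpMod_neg]
    refine (lpMod_shift_le (measurableSet_box L) (measurable_fwdDiff _ hG) _
      fun x hx => hx.2).trans (h (-w) ⟨by linarith, by linarith [hw.1]⟩)

/-- A function on a square with small first differences of step one and small differences of
order `r` in both coordinate directions is close to a constant. -/
lemma exists_const_near (hp : 0 < p) (r L : ℕ) (hL : 1 ≤ L) :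
    ∃ C : ℝ≥0, ∃ m : ℕ, ∀ (μ : Measure (ℝ × ℝ)) [μ.IsAddHaarMeasure] (G : ℝ × ℝ → ℝ),
      Measurable G → (∀ L, lpMod p μ (box L) G ≠ ∞) → ∀ η : ℝ≥0∞,
        (∀ e ∈ ({(1, 0), (0, 1)} : Set (ℝ × ℝ)), lpMod p μ (box m) (fwdDiff e G) ≤ η ∧
          ∀ u ∈ Icc (0 : ℝ) 1, lpMod p μ (box m) ((fwdDiff (u • e))^[r] G) ≤ η) →
        ∃ c : ℝ, lpMod p μ (box L) (fun x => G x - c) ≤ C * η := by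
  obtain ⟨C, m, hCm⟩ := marchaud hp r r 1 le_rfl (by omega)
  -- A step u ≤ L is cut into L steps u / L ≤ 1. They enlarge the square by L, and `marchaud`
  -- enlarges it by m more.
  refine ⟨4 * (L * C + L * C), 2 * L + m, fun μ _ G hG hfin η h => ?_⟩
  have hL0 : (0 : ℝ) < L := by exact_mod_cast hL
  have hstep : ∀ e ∈ ({(1, 0), (0, 1)} : Set (ℝ × ℝ)), IsStep e := by
    rintro e (rfl | rfl) <;> simp [IsStep]
  have hdir : ∀ e ∈ ({(1, 0), (0, 1)} : Set (ℝ × ℝ)), ∀ u ∈ Icc (0 : ℝ) L,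
      lpMod p μ (box L) (fwdDiff (u • e) G) ≤ L * C * η := by
    intro e he u hu
    have hu' : u / L ∈ Icc (0 : ℝ) 1 := ⟨by have := hu.1; positivity, (div_le_one hL0).2 hu.2⟩
    have hun : u • e = L • ((u / L) • e) := by
      rw [← Nat.cast_smul_eq_nsmul ℝ, smul_smul, mul_div_cancel₀ _ hL0.ne']
    rw [hun]
    refine (lpMod_fwdDiff_nsmul_le hp ((hstep e he).smul hu') hG L L).trans ?_
    rw [mul_assoc]
    gcongr
    have := hCm μ e (hstep e he) G hG hfin (L + L) η (by simpa [two_mul] using (h e he).1)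
      (by simpa [two_mul] using (h e he).2) _ hu'
    simpa using this
  have := exists_lpMod_sub_const_le hp μ hG hL0 (η := L * C * η + L * C * η) ?_
  · obtain ⟨c, hc⟩ := this
    refine ⟨c, hc.trans (le_of_eq ?_)⟩
    push_cast
    ring
  · intro v hv
    have h1 := lpMod_shift_sub_le hG (hdir (1, 0) (by simp)) hv.1
    have h2 := lpMod_shift_sub_le hG (hdir (0, 1) (by simp)) hv.2
    -- The path turns at the corner x + (0, v.2), which stays in the square because its coordinates
    -- are those of x and of x + v.
    have hsplit : (fun x => G (x + v) - G x) = fun x =>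
        (G (x + v.2 • (0, 1) + v.1 • (1, 0)) - G (x + v.2 • (0, 1))) +
          (G (x + v.2 • (0, 1)) - G x) := by
      funext x
      have : x + v.2 • ((0, 1) : ℝ × ℝ) + v.1 • (1, 0) = x + v := by ext <;> simp
      rw [this]
      ring
    rw [hsplit]
    have hms : ∀ w : ℝ × ℝ, Measurable fun x => G (x + w) - G x := fun w => measurable_fwdDiff w hG
    refine (lpMod_add_le ((hms (v.1 • (1, 0))).comp (measurable_id.add_const _)) (hms _)).trans
      (add_le_add ?_ ?_)
    · refine (lpMod_shift_le (F := fun x => G (x + v.1 • (1, 0)) - G x)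
        (B := {x | x ∈ box L ∧ x + v.1 • (1, 0) ∈ box L}) ?_ (hms _) _ ?_).trans h1
      · exact (measurableSet_box _).inter (measurable_id.add_const _ (measurableSet_box _))
      · rintro x ⟨⟨⟨a1, a2⟩, a3, a4⟩, ⟨b1, b2⟩, b3, b4⟩
        simp only [Prod.fst_add, Prod.snd_add] at b1 b2 b3 b4
        constructor <;> refine mem_box.2 ⟨⟨?_, ?_⟩, ?_, ?_⟩ <;> simpa
    · refine (lpMod_mono ?_).trans h2
      rintro x ⟨⟨⟨a1, a2⟩, a3, a4⟩, ⟨b1, b2⟩, b3, b4⟩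
      simp only [Prod.fst_add, Prod.snd_add] at b1 b2 b3 b4
      constructor <;> refine mem_box.2 ⟨⟨?_, ?_⟩, ?_, ?_⟩ <;> simpa

end Averaging

/-! ### Polynomials of bounded degree in each variable -/

section PolySpace

/-- The polynomials in two variables of degree `< r` in each variable, as functions. -/
def polySpace (r : ℕ) : Submodule ℝ (ℝ × ℝ → ℝ) :=
  Submodule.span ℝ {q | ∃ i < r, ∃ j < r, q = fun z => z.1 ^ i * z.2 ^ j}

variable {r : ℕ} {p : ℝ≥0∞}

lemma continuous_of_mem_polySpace {q : ℝ × ℝ → ℝ} (hq : q ∈ polySpace r) : Continuous q := by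
  induction hq using Submodule.span_induction with
  | mem q hq =>
    obtain ⟨i, -, j, -, rfl⟩ := hq
    fun_prop
  | zero => exact continuous_const
  | add f g _ _ hf hg => exact hf.add hg
  | smul c f _ hf => exact hf.const_smul c

/-- The difference with step u at x is the difference with step 1 at t = 0 of the polynomial (x + u
t)^i, whose degree is less than k. -/
lemma fwdDiff_iter_pow_eq_zero {i k : ℕ} (h : i < k) (u : ℝ) :
    (fwdDiff u)^[k] (fun x : ℝ => x ^ i) = fun _ => 0 := by
  funext x
  have h1 : ((Polynomial.C x + Polynomial.C u * Polynomial.X) ^ i).natDegree < k := by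
    refine lt_of_le_of_lt ?_ h
    compute_degree
  have h2 := congrFun (Polynomial.fwdDiff_iter_eq_zero_of_degree_lt h1) 0
  rw [fwdDiff_iter_eq_sum_shift] at h2 ⊢
  simp only [Polynomial.eval_pow, Polynomial.eval_add, Polynomial.eval_C, Polynomial.eval_mul,
    Polynomial.eval_X, zero_add, nsmul_eq_mul, mul_one, Pi.zero_apply] at h2 ⊢
  simpa only [mul_comm u] using h2

lemma fwdDiff_iter_fst_mul (u : ℝ) (k : ℕ) (f g : ℝ → ℝ) :
    (fwdDiff (u • ((1, 0) : ℝ × ℝ)))^[k] (fun z => f z.1 * g z.2) =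
      fun z => (fwdDiff u)^[k] f z.1 * g z.2 := by
  induction k generalizing f with
  | zero => rfl
  | succ k ih =>
    rw [Function.iterate_succ_apply, Function.iterate_succ_apply, ← ih]
    congr 1
    funext z
    simp [fwdDiff]
    ring

lemma fwdDiff_iter_snd_mul (u : ℝ) (k : ℕ) (f g : ℝ → ℝ) :
    (fwdDiff (u • ((0, 1) : ℝ × ℝ)))^[k] (fun z => f z.1 * g z.2) =
      fun z => f z.1 * (fwdDiff u)^[k] g z.2 := by
  induction k generalizing g with
  | zero => rfl
  | succ k ih =>
    rw [Function.iterate_succ_apply, Function.iterate_succ_apply, ← ih]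
    congr 1
    funext z
    simp [fwdDiff]
    ring

lemma fwdDiff_iter_eq_zero_of_mem_polySpace {q : ℝ × ℝ → ℝ} (hq : q ∈ polySpace r)
    {e : ℝ × ℝ} (he : e ∈ ({(1, 0), (0, 1)} : Set (ℝ × ℝ))) (u : ℝ) :
    (fwdDiff (u • e))^[r] q = fun _ => 0 := by
  induction hq using Submodule.span_induction with
  | mem q hq =>
    obtain ⟨i, hi, j, hj, rfl⟩ := hq
    rcases he with rfl | rfl
    · rw [fwdDiff_iter_fst_mul u r (fun x => x ^ i) fun x => x ^ j, fwdDiff_iter_pow_eq_zero hi]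
      simp
    · rw [fwdDiff_iter_snd_mul u r (fun x => x ^ i) fun x => x ^ j, fwdDiff_iter_pow_eq_zero hj]
      simp
  | zero =>
    funext x
    simp [fwdDiff_iter_eq_sum_shift]
  | add f g _ _ hf hg =>
    rw [fwdDiff_iter_add, hf, hg]
    funext x
    simp
  | smul c f _ hf =>
    rw [fwdDiff_iter_const_smul, hf]
    funext x
    simp

lemma fwdDiff_iter_sub {M : Type*} [AddCommGroup M] (h : M) (k : ℕ) (f g : M → ℝ) :
    (fwdDiff h)^[k] (fun x => f x - g x) = fun x => (fwdDiff h)^[k] f x - (fwdDiff h)^[k] g x := by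
  funext x
  simp [fwdDiff_iter_eq_sum_shift, mul_sub, Finset.sum_sub_distrib]

lemma fwdDiff_iter_sub_of_mem_polySpace {q : ℝ × ℝ → ℝ} (hq : q ∈ polySpace r)
    {e : ℝ × ℝ} (he : e ∈ ({(1, 0), (0, 1)} : Set (ℝ × ℝ))) (u : ℝ) (F : ℝ × ℝ → ℝ) :
    (fwdDiff (u • e))^[r] (fun x => F x - q x) = (fwdDiff (u • e))^[r] F := by
  rw [fwdDiff_iter_sub, fwdDiff_iter_eq_zero_of_mem_polySpace hq he]
  simp

lemma lpMod_ne_top_of_bounded {α : Type*} [MeasurableSpace α] {μ : Measure α} {A : Set α}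
    (hA : MeasurableSet A) (hμ : μ A ≠ ∞) {F : α → ℝ} (hF : Measurable F) {M : ℝ}
    (h : ∀ x ∈ A, ‖F x‖ ≤ M) : lpMod p μ A F ≠ ∞ := by
  refine ENNReal.rpow_ne_top_of_nonneg ENNReal.toReal_nonneg ?_
  unfold lpOn
  split_ifs with hp
  · refine ne_top_of_le_ne_top (b := ENNReal.ofReal M) ENNReal.ofReal_ne_top ?_
    refine iSup₂_le fun x hx => ?_
    rw [← ofReal_norm]
    exact ENNReal.ofReal_le_ofReal (h x hx)
  · have : IsFiniteMeasure (μ.restrict A) := ⟨by simpa using hμ.lt_top⟩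
    exact (MemLp.of_bound hF.aestronglyMeasurable M
      ((ae_restrict_iff' hA).2 (Filter.Eventually.of_forall h))).2.ne

lemma lpMod_box_ne_top_of_mem_polySpace {μ : Measure (ℝ × ℝ)} [μ.IsAddHaarMeasure]
    {q : ℝ × ℝ → ℝ} (hq : q ∈ polySpace r) (L : ℝ) : lpMod p μ (box L) q ≠ ∞ := by
  have hc := continuous_of_mem_polySpace hq
  obtain ⟨M, hM⟩ := (isCompact_Icc.prod isCompact_Icc : IsCompact (box L)).exists_bound_of_continuousOn
    hc.continuousOn
  exact lpMod_ne_top_of_bounded (measurableSet_box L) (measure_box_ne_top μ L) hc.measurable hM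

end PolySpace

/-! ### The Whitney inequality on a square -/

section Box

variable {r : ℕ} {p : ℝ≥0∞}

/-- The mixed difference of order `i` in the first and `j` in the second variable. -/
def mixDiff (i j : ℕ) (F : ℝ × ℝ → ℝ) : ℝ × ℝ → ℝ :=
  (fwdDiff ((1, 0) : ℝ × ℝ))^[i] ((fwdDiff ((0, 1) : ℝ × ℝ))^[j] F)

lemma isStep_fst : IsStep (1, 0) := by simp [IsStep]

lemma isStep_snd : IsStep (0, 1) := by simp [IsStep]

lemma measurable_mixDiff (i j : ℕ) {F : ℝ × ℝ → ℝ} (hF : Measurable F) :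
    Measurable (mixDiff i j F) :=
  measurable_fwdDiff_iter _ _ (measurable_fwdDiff_iter _ _ hF)

lemma mixDiff_sub (i j : ℕ) (F G : ℝ × ℝ → ℝ) :
    mixDiff i j (fun x => F x - G x) = fun x => mixDiff i j F x - mixDiff i j G x := by
  rw [mixDiff, fwdDiff_iter_sub, fwdDiff_iter_sub]
  rfl

lemma mixDiff_monomial (i j a b : ℕ) (c : ℝ) :
    mixDiff i j (fun z => c * (z.1 ^ a * z.2 ^ b)) = fun z =>
      c * ((fwdDiff (1 : ℝ))^[i] (fun x => x ^ a) z.1 * (fwdDiff (1 : ℝ))^[j] (fun x => x ^ b) z.2) := by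
  have h1 := fwdDiff_iter_snd_mul 1 j (fun x => c * x ^ a) fun x => x ^ b
  have h2 := fwdDiff_iter_fst_mul 1 i (fun x => c * x ^ a) ((fwdDiff (1 : ℝ))^[j] fun x => x ^ b)
  rw [one_smul] at h1 h2
  have h3 : (fwdDiff (1 : ℝ))^[i] (fun x => c * x ^ a) = c • (fwdDiff (1 : ℝ))^[i] (fun x => x ^ a) :=
    fwdDiff_iter_const_smul (1 : ℝ) c (fun x : ℝ => x ^ a) i
  simp only [mul_assoc] at h1
  rw [mixDiff, h1]
  simp only [← mul_assoc]
  rw [h2, h3]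
  rfl

lemma mixDiff_monomial_eq_zero {i j a b : ℕ} (h : a < i ∨ b < j) (c : ℝ) :
    mixDiff i j (fun z => c * (z.1 ^ a * z.2 ^ b)) = fun _ => 0 := by
  rw [mixDiff_monomial]
  rcases h with h | h <;> simp [fwdDiff_iter_pow_eq_zero h]

lemma mixDiff_monomial_self (i j : ℕ) (c : ℝ) :
    mixDiff i j (fun z => c / (i.factorial * j.factorial) * (z.1 ^ i * z.2 ^ j)) = fun _ => c := by
  rw [mixDiff_monomial]
  funext z
  have h : ∀ k : ℕ, ∀ x : ℝ, (fwdDiff (1 : ℝ))^[k] (fun x => x ^ k) x = k.factorial := fun k x => by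
    rw [fwdDiff_iter_eq_factorial]
    rfl
  rw [h, h]
  have := Nat.factorial_ne_zero i
  have := Nat.factorial_ne_zero j
  field_simp

lemma fwdDiff_fst_mixDiff (i j : ℕ) (F : ℝ × ℝ → ℝ) :
    fwdDiff (1, 0) (mixDiff i j F) = mixDiff (i + 1) j F := by
  rw [mixDiff, mixDiff, Function.iterate_succ_apply']

lemma fwdDiff_snd_mixDiff (i j : ℕ) (F : ℝ × ℝ → ℝ) :
    fwdDiff (0, 1) (mixDiff i j F) = mixDiff i (j + 1) F := by
  rw [mixDiff, mixDiff, Function.iterate_succ_apply']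
  exact fwdDiff_iter_comm _ _ 1 i _

lemma fwdDiff_iter_mixDiff (a : ℝ × ℝ) (k i j : ℕ) (F : ℝ × ℝ → ℝ) :
    (fwdDiff a)^[k] (mixDiff i j F) = mixDiff i j ((fwdDiff a)^[k] F) := by
  rw [mixDiff, mixDiff, fwdDiff_iter_comm, fwdDiff_iter_comm a]

lemma lpMod_mixDiff_le {μ : Measure (ℝ × ℝ)} [μ.IsAddLeftInvariant] {F : ℝ × ℝ → ℝ}
    (hF : Measurable F) (i j : ℕ) (L : ℝ) :
    lpMod p μ (box L) (mixDiff i j F) ≤ 2 ^ (i + j) * lpMod p μ (box (L + i + j)) F := by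
  refine (lpMod_fwdDiff_iter_box_le isStep_fst (measurable_fwdDiff_iter _ _ hF) L i).trans ?_
  rw [pow_add, mul_assoc]
  gcongr
  exact lpMod_fwdDiff_iter_box_le isStep_snd hF _ j

lemma lpMod_mixDiff_le_of_order {μ : Measure (ℝ × ℝ)} [μ.IsAddLeftInvariant] {F : ℝ × ℝ → ℝ}
    (hF : Measurable F) {L : ℝ} {η : ℝ≥0∞}
    (h : ∀ e ∈ ({(1, 0), (0, 1)} : Set (ℝ × ℝ)), ∀ u ∈ Icc (0 : ℝ) 1,
      lpMod p μ (box (L + r)) ((fwdDiff (u • e))^[r] F) ≤ η) {i j : ℕ} (hi : i ≤ r) (hj : j ≤ r)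
    (hij : i = r ∨ j = r) : lpMod p μ (box L) (mixDiff i j F) ≤ 2 ^ r * η := by
  rcases hij with rfl | rfl
  · rw [mixDiff, fwdDiff_iter_comm]
    refine (lpMod_fwdDiff_iter_box_le isStep_snd (measurable_fwdDiff_iter _ _ hF) L j).trans ?_
    refine mul_le_mul' (pow_le_pow_right₀ one_le_two hj) ?_
    refine (lpMod_mono (B := box (L + i)) (box_mono (by gcongr))).trans ?_
    simpa using h (1, 0) (by simp) 1 (by simp)
  · refine (lpMod_fwdDiff_iter_box_le isStep_fst (measurable_fwdDiff_iter _ _ hF) L i).trans ?_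
    refine mul_le_mul' (pow_le_pow_right₀ one_le_two hi) ?_
    refine (lpMod_mono (B := box (L + j)) (box_mono (by gcongr))).trans ?_
    simpa using h (0, 1) (by simp) 1 (by simp)

/-- The pair (i, j) is coded by i r + j, so d counts how many pairs with i, j < r have been treated
from the top. Pairs with j = r are listed separately because their code collides with that of (i +
1, 0). For d = 0 only i = r or j = r remains, where the hypothesis on r-th differences applies; d =
r² includes (0, 0). -/
lemma exists_poly_mixDiff_le (hp : 0 < p) (hr : 1 ≤ r) (d : ℕ) (hd : d ≤ r * r) (L : ℕ)
    (hL : 1 ≤ L) :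
    ∃ C : ℝ≥0, ∃ m : ℕ, ∀ (μ : Measure (ℝ × ℝ)) [μ.IsAddHaarMeasure] (F : ℝ × ℝ → ℝ),
      Measurable F → (∀ L, lpMod p μ (box L) F ≠ ∞) → ∀ η : ℝ≥0∞,
        (∀ e ∈ ({(1, 0), (0, 1)} : Set (ℝ × ℝ)), ∀ u ∈ Icc (0 : ℝ) 1,
          lpMod p μ (box m) ((fwdDiff (u • e))^[r] F) ≤ η) →
        ∃ q ∈ polySpace r, ∀ i j, i ≤ r → j ≤ r → r * r ≤ i * r + j + d ∨ j = r →
          lpMod p μ (box L) (mixDiff i j fun x => F x - q x) ≤ C * η := by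
  induction d generalizing L with
  | zero =>
    refine ⟨2 ^ r, L + r, fun μ _ F hF hfin η h => ⟨0, Submodule.zero_mem _, ?_⟩⟩
    intro i j hi hj hij
    simp only [Pi.zero_apply, sub_zero]
    have hij' : i = r ∨ j = r := by
      rcases hij with hij | hij
      · by_contra! hne
        have h1 : i + 1 ≤ r := by omega
        have h2 : j < r := by omega
        nlinarith
      · exact Or.inr hij
    exact_mod_cast lpMod_mixDiff_le_of_order hF (by exact_mod_cast h) hi hj hij'
  | succ d ih =>
    obtain ⟨C₁, m₁, hconst⟩ := exists_const_near hp r L hL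
    obtain ⟨C₂, m₂, hind⟩ := ih (by omega) (max L m₁) (le_max_of_le_left hL)
    -- The one new pair (a, b) is read off from its code n in base r.
    set n := r * r - (d + 1) with hn
    set a := n / r with ha
    set b := n % r with hb
    have hnab : a * r + b = n := by
      rw [mul_comm]
      exact Nat.div_add_mod n r
    have hb' : b < r := Nat.mod_lt _ (by omega)
    have ha' : a < r := (Nat.div_lt_iff_lt_mul (by omega)).2 (by omega)
    refine ⟨C₂ + C₁ * (C₂ + 2 ^ (a + b)), max m₂ (m₁ + a + b), fun μ _ F hF hfin η h => ?_⟩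
    obtain ⟨q, hq, hqle⟩ := hind μ F hF hfin η fun e he u hu =>
      (lpMod_mono (box_mono (by exact_mod_cast le_max_left _ _))).trans (h e he u hu)
    have hqm : Measurable q := (continuous_of_mem_polySpace hq).measurable
    have hFq : Measurable fun x => F x - q x := hF.sub hqm
    have hbox₁ : box (m₁ : ℝ) ⊆ box ((max L m₁ : ℕ) : ℝ) :=
      box_mono (by exact_mod_cast le_max_right _ _)
    have hbox₂ : box (L : ℝ) ⊆ box ((max L m₁ : ℕ) : ℝ) :=
      box_mono (by exact_mod_cast le_max_left _ _)
    have hmod : ∀ e ∈ ({(1, 0), (0, 1)} : Set (ℝ × ℝ)), ∀ u ∈ Icc (0 : ℝ) 1,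
        lpMod p μ (box m₁) ((fwdDiff (u • e))^[r] (mixDiff a b fun x => F x - q x)) ≤
          2 ^ (a + b) * η := by
      intro e he u hu
      rw [fwdDiff_iter_mixDiff, fwdDiff_iter_sub_of_mem_polySpace hq he]
      refine (lpMod_mixDiff_le (measurable_fwdDiff_iter _ _ hF) a b _).trans ?_
      gcongr
      exact (lpMod_mono (box_mono (by exact_mod_cast le_max_right _ _))).trans (h e he u hu)
    have hcoe : ((C₂ + 2 ^ (a + b) : ℝ≥0) : ℝ≥0∞) * η = C₂ * η + 2 ^ (a + b) * η := by
      push_cast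
      rw [add_mul]
    obtain ⟨c, hc⟩ := hconst μ (mixDiff a b fun x => F x - q x) (measurable_mixDiff a b hFq)
      (fun K => ne_top_of_le_ne_top (ENNReal.mul_ne_top (by simp)
        (ne_top_of_le_ne_top (ENNReal.add_ne_top.2 ⟨hfin _, lpMod_box_ne_top_of_mem_polySpace hq _⟩)
          (lpMod_sub_le hF hqm))) (lpMod_mixDiff_le hFq a b K))
      ((C₂ + 2 ^ (a + b) : ℝ≥0) * η) (by
        intro e he
        refine ⟨?_, fun u hu => (hmod e he u hu).trans (hcoe ▸ le_add_self)⟩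
        rw [hcoe]
        refine le_trans ?_ le_self_add
        refine (lpMod_mono hbox₁).trans ?_
        -- The unit differences raise the order to (a + 1, b) and (a, b + 1), with codes n + r and n
        -- + 1, both already treated.
        rcases he with rfl | rfl
        · rw [fwdDiff_fst_mixDiff]
          refine hqle _ _ (by omega) (by omega) (Or.inl ?_)
          rw [add_mul]
          omega
        · rw [fwdDiff_snd_mixDiff]
          refine hqle _ _ (by omega) (by omega) (Or.inl ?_)
          omega)
    -- The factorials make the mixed difference of order (a, b) of this monomial equal to c.
    set g : ℝ × ℝ → ℝ := fun z => c / (a.factorial * b.factorial) * (z.1 ^ a * z.2 ^ b) with hg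
    have hgmem : g ∈ polySpace r :=
      Submodule.smul_mem _ (c / (a.factorial * b.factorial))
        (Submodule.subset_span ⟨a, ha', b, hb', rfl⟩)
    refine ⟨q + g, Submodule.add_mem _ hq hgmem, fun i j hi hj hij => ?_⟩
    have hsub : (fun x => F x - (q + g) x) = fun x => (F x - q x) - g x := by
      funext x
      simp [sub_sub]
    rw [hsub, mixDiff_sub]
    by_cases hab : i = a ∧ j = b
    · obtain ⟨rfl, rfl⟩ := hab
      rw [hg, mixDiff_monomial_self]
      refine hc.trans ?_
      push_cast
      rw [← mul_assoc]
      gcongr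
      exact le_add_self
    · have hlt : r * r ≤ i * r + j + d ∨ j = r := by
        rcases hij with hij | hij
        · by_contra! hne
          have hj' : j < r := by omega
          have heq : i * r + j = n := by omega
          refine hab ⟨?_, ?_⟩
          · rw [ha, ← heq, mul_comm i, Nat.mul_add_div (by omega), Nat.div_eq_of_lt hj', add_zero]
          · rw [hb, ← heq, mul_comm i, Nat.mul_add_mod, Nat.mod_eq_of_lt hj']
        · exact Or.inr hij
      -- A pair treated earlier exceeds (a, b) in some coordinate, so its mixed difference
      -- annihilates the new monomial and the old bound survives.
      have hgt : a < i ∨ b < j := by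
        by_contra! hle
        rcases hlt with hlt | hlt
        · have := Nat.mul_le_mul_right r hle.1
          omega
        · omega
      rw [hg, mixDiff_monomial_eq_zero hgt]
      simp only [sub_zero]
      refine ((lpMod_mono hbox₂).trans (hqle i j hi hj hlt)).trans ?_
      push_cast
      gcongr
      exact le_self_add

/-- The Whitney inequality on a square, for polynomials of degree `< r` in each variable. -/
lemma exists_poly_near (hp : 0 < p) (hr : 1 ≤ r) :
    ∃ C : ℝ≥0, ∃ m : ℕ, ∀ (μ : Measure (ℝ × ℝ)) [μ.IsAddHaarMeasure] (F : ℝ × ℝ → ℝ),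
      Measurable F → (∀ L, lpMod p μ (box L) F ≠ ∞) → ∀ η : ℝ≥0∞,
        (∀ e ∈ ({(1, 0), (0, 1)} : Set (ℝ × ℝ)), ∀ u ∈ Icc (0 : ℝ) 1,
          lpMod p μ (box m) ((fwdDiff (u • e))^[r] F) ≤ η) →
        ∃ q ∈ polySpace r, lpMod p μ (box 1) (fun x => F x - q x) ≤ C * η := by
  obtain ⟨C, m, h⟩ := exists_poly_mixDiff_le hp hr (r * r) le_rfl 1 le_rfl
  refine ⟨C, m, fun μ _ F hF hfin η hη => ?_⟩
  obtain ⟨q, hq, hle⟩ := h μ F hF hfin η hη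
  refine ⟨q, hq, ?_⟩
  simpa [mixDiff] using hle 0 0 (by omega) (by omega) (Or.inl (by omega))

end Box

/-! ### Extending bounds along lines -/

section Extension

variable {r : ℕ} {p : ℝ≥0∞}

/-- The `r`-th differences of `H` along both coordinate axes are bounded by `η` over `K`. -/
def OrderBound (p : ℝ≥0∞) (μ : Measure (ℝ × ℝ)) (r : ℕ) (K : Set (ℝ × ℝ)) (H : ℝ × ℝ → ℝ)
    (η : ℝ≥0∞) : Prop :=
  ∀ e ∈ ({(1, 0), (0, 1)} : Set (ℝ × ℝ)), ∀ u : ℝ,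
    lpMod p μ {z | z ∈ K ∧ z + (r : ℝ) • (u • e) ∈ K} ((fwdDiff (u • e))^[r] H) ≤ η

lemma convex_line_preimage {E : Type*} [AddCommGroup E] [Module ℝ E] {K : Set E}
    (hK : Convex ℝ K) (z e : E) : Convex ℝ {t : ℝ | z + t • e ∈ K} := by
  intro s hs t ht a b ha hb hab
  have := hK hs ht ha hb hab
  have heq : a • (z + s • e) + b • (z + t • e) = z + (a • s + b • t) • e := by
    have : z = (a + b) • z := by rw [hab, one_smul]
    conv_rhs => rw [this]
    simp only [smul_eq_mul]
    module
  rw [heq] at this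
  exact this

lemma add_smul_mem_of_mem_Icc {E : Type*} [AddCommGroup E] [Module ℝ E] {K : Set E}
    (hK : Convex ℝ K) {z e : E} {s t u : ℝ} (hs : z + s • e ∈ K) (ht : z + t • e ∈ K)
    (hu : u ∈ Icc s t) : z + u • e ∈ K :=
  (convex_line_preimage hK z e).ordConnected.out hs ht hu

/-- The constant of the extension step. -/
noncomputable def extConst (p : ℝ≥0∞) (r : ℕ) : ℝ≥0 :=
  ∑ j ∈ Finset.range r, ‖(-1 : ℝ) ^ (r - (j + 1)) * (r.choose (j + 1) : ℝ)‖₊ ^ subExp p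

/-- Solve the formula for the r-th difference for its term j = 0: the value at x is then given by
the difference and the values at x + h, …, x + r h. -/
lemma lpMod_le_fwdDiff_iter_add (hp : 0 < p) {μ : Measure (ℝ × ℝ)} [μ.IsAddLeftInvariant]
    {A B : Set (ℝ × ℝ)} (hA : MeasurableSet A) {H : ℝ × ℝ → ℝ} (hH : Measurable H) (h : ℝ × ℝ)
    (hAB : ∀ b ∈ B, ∀ j, 1 ≤ j → j ≤ r → b + (j : ℝ) • h ∈ A) :
    lpMod p μ B H ≤ lpMod p μ B ((fwdDiff h)^[r] H) + extConst p r * lpMod p μ A H := by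
  have hcoef : ∀ c : ℝ, ((‖c‖₊ ^ subExp p : ℝ≥0) : ℝ≥0∞) = ‖c‖ₑ ^ subExp p := fun c => by
    rw [ENNReal.coe_rpow_of_nonneg _ (subExp_pos hp).le, enorm_eq_nnnorm]
  have hid : (fun x => (-1 : ℝ) ^ r * H x) = fun x => (fwdDiff h)^[r] H x -
      ∑ j ∈ Finset.range r, ((-1 : ℝ) ^ (r - (j + 1)) * (r.choose (j + 1) : ℝ)) *
        H (x + ((j + 1 : ℕ) : ℝ) • h) := by
    funext x
    rw [fwdDiff_iter_eq_sum_shift, Finset.sum_range_succ']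
    simp only [Nat.cast_smul_eq_nsmul]
    simp
  have hm : ∀ j : ℕ, Measurable fun x => H (x + ((j + 1 : ℕ) : ℝ) • h) :=
    fun j => hH.comp (measurable_id.add_const _)
  have h1 : lpMod p μ B H = lpMod p μ B (fun x => (-1 : ℝ) ^ r * H x) := by
    rw [lpMod_const_mul]
    simp
  rw [h1, hid]
  refine (lpMod_sub_le (measurable_fwdDiff_iter _ _ hH)
    (Finset.measurable_sum _ fun j _ => (hm j).const_mul _)).trans (add_le_add le_rfl ?_)
  refine (lpMod_sum_le hp _ _ fun j _ => (hm j).const_mul _).trans ?_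
  rw [extConst, ENNReal.ofNNReal_finsetSum, Finset.sum_mul]
  refine Finset.sum_le_sum fun j hj => ?_
  rw [lpMod_const_mul, hcoef]
  gcongr
  exact lpMod_shift_le hA hH _ fun b hb => hAB b hb (j + 1) (by omega)
    (Finset.mem_range.1 hj)

lemma lpMod_le_of_orderBound (hp : 0 < p) {μ : Measure (ℝ × ℝ)} [μ.IsAddLeftInvariant]
    {K A B : Set (ℝ × ℝ)} (hA : MeasurableSet A) (hAK : A ⊆ K) (hBK : B ⊆ K) (hr : 1 ≤ r)
    {H : ℝ × ℝ → ℝ}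
    (hH : Measurable H) {η : ℝ≥0∞} (hord : OrderBound p μ r K H η) {e : ℝ × ℝ}
    (he : e ∈ ({(1, 0), (0, 1)} : Set (ℝ × ℝ))) (u : ℝ)
    (hAB : ∀ b ∈ B, ∀ j, 1 ≤ j → j ≤ r → b + (j : ℝ) • (u • e) ∈ A) :
    lpMod p μ B H ≤ η + extConst p r * lpMod p μ A H := by
  refine (lpMod_le_fwdDiff_iter_add hp hA hH (u • e) hAB).trans (add_le_add ?_ le_rfl)
  exact (lpMod_mono (B := {z | z ∈ K ∧ z + (r : ℝ) • (u • e) ∈ K})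
    fun b hb => ⟨hBK hb, hAK (hAB b hb r hr le_rfl)⟩).trans (hord e he u)

/-- S is a union of lines of direction e, φ is the position along them, and the core is the part
with φ in [a, a + l]. The covered range grows by d = l / r at each end: from a point of a new layer,
the r steps of length d back towards the core land in the covered range. The constant does not
depend on l, so arbitrarily short cores are allowed. -/
lemma exists_lpMod_strip_le (hp : 0 < p) (hr : 1 ≤ r) (C₀ : ℝ≥0) (M : ℕ) :
    ∃ C : ℝ≥0, ∀ (μ : Measure (ℝ × ℝ)) [μ.IsAddLeftInvariant] (K : Set (ℝ × ℝ)),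
      Convex ℝ K → MeasurableSet K → ∀ (H : ℝ × ℝ → ℝ), Measurable H → ∀ η : ℝ≥0∞,
      OrderBound p μ r K H η → ∀ e ∈ ({(1, 0), (0, 1)} : Set (ℝ × ℝ)), ∀ φ : ℝ × ℝ → ℝ,
      Measurable φ → (∀ z t, φ (z + t • e) = φ z + t) → ∀ S : Set (ℝ × ℝ), MeasurableSet S →
      (∀ z ∈ S, ∀ t : ℝ, z + t • e ∈ S) → ∀ a l : ℝ, 0 ≤ l →
      (∀ z ∈ S, φ z ∈ Icc a (a + l) → z ∈ K) →
      lpMod p μ {z | z ∈ S ∧ φ z ∈ Icc a (a + l)} H ≤ C₀ * η →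
      lpMod p μ {z | (z ∈ K ∧ z ∈ S) ∧ φ z ∈ Icc (a - M * l) (a + l + M * l)} H ≤ C * η := by
  suffices hmain : ∀ n : ℕ, ∃ C : ℝ≥0, ∀ (μ : Measure (ℝ × ℝ)) [μ.IsAddLeftInvariant]
      (K : Set (ℝ × ℝ)),
      Convex ℝ K → MeasurableSet K → ∀ (H : ℝ × ℝ → ℝ), Measurable H → ∀ η : ℝ≥0∞,
      OrderBound p μ r K H η → ∀ e ∈ ({(1, 0), (0, 1)} : Set (ℝ × ℝ)), ∀ φ : ℝ × ℝ → ℝ,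
      Measurable φ → (∀ z t, φ (z + t • e) = φ z + t) → ∀ S : Set (ℝ × ℝ), MeasurableSet S →
      (∀ z ∈ S, ∀ t : ℝ, z + t • e ∈ S) → ∀ a d : ℝ, 0 ≤ d →
      (∀ z ∈ S, φ z ∈ Icc a (a + r * d) → z ∈ K) →
      lpMod p μ {z | z ∈ S ∧ φ z ∈ Icc a (a + r * d)} H ≤ C₀ * η →
      lpMod p μ {z | (z ∈ K ∧ z ∈ S) ∧ φ z ∈ Icc (a - n * d) (a + r * d + n * d)} H ≤ C * η by
    -- M r layers of thickness l / r make up the distance M l.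
    obtain ⟨C, hC⟩ := hmain (M * r)
    refine ⟨C, fun μ _ K hK hKm H hH η hord e he φ hφ hφe S hS hSe a l hl hsub hle => ?_⟩
    have hr0 : (r : ℝ) ≠ 0 := by positivity
    have hl' : (r : ℝ) * (l / r) = l := mul_div_cancel₀ _ hr0
    have := hC μ K hK hKm H hH η hord e he φ hφ hφe S hS hSe a (l / r) (by positivity)
      (by rwa [hl']) (by rwa [hl'])
    rwa [hl', show ((M * r : ℕ) : ℝ) * (l / r) = M * l by push_cast; rw [mul_assoc, hl']] at this
  intro n
  induction n with
  | zero =>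
    refine ⟨C₀, fun μ _ K hK hKm H hH η hord e he φ hφ hφe S hS hSe a d hd hsub hle => ?_⟩
    refine (lpMod_mono ?_).trans hle
    rintro z ⟨⟨-, hz⟩, hz'⟩
    exact ⟨hz, by simpa using hz'⟩
  | succ n ih =>
    obtain ⟨C, hC⟩ := ih
    refine ⟨C + ((1 + extConst p r * C) + (1 + extConst p r * C)),
      fun μ _ K hK hKm H hH η hord e he φ hφ hφe S hS hSe a d hd hsub hle => ?_⟩
    have hZ := hC μ K hK hKm H hH η hord e he φ hφ hφe S hS hSe a d hd hsub hle
    have hmeas : ∀ s t : ℝ, MeasurableSet {z | (z ∈ K ∧ z ∈ S) ∧ φ z ∈ Icc s t} := fun s t =>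
      (hKm.inter hS).inter (hφ measurableSet_Icc)
    set Z := {z | (z ∈ K ∧ z ∈ S) ∧ φ z ∈ Icc (a - n * d) (a + r * d + n * d)} with hZdef
    have hrd : 0 ≤ (r : ℝ) * d := by positivity
    have hnd : 0 ≤ (n : ℝ) * d := by positivity
    have hcore : ∀ z ∈ S, ∀ t : ℝ, φ z + t ∈ Icc a (a + r * d) → z + t • e ∈ K := fun z hz t ht =>
      hsub _ (hSe z hz t) (by rwa [hφe])
    have hjd : ∀ j : ℕ, 1 ≤ j → j ≤ r → d ≤ j * d ∧ j * d ≤ r * d := fun j h1 h2 =>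
      ⟨le_mul_of_one_le_left hd (by exact_mod_cast h1),
        mul_le_mul_of_nonneg_right (by exact_mod_cast h2) hd⟩
    have hright : lpMod p μ {z | (z ∈ K ∧ z ∈ S) ∧
        φ z ∈ Icc (a + r * d + n * d) (a + r * d + (n + 1 : ℕ) * d)} H ≤
        η + extConst p r * lpMod p μ Z H := by
      refine lpMod_le_of_orderBound hp (hmeas _ _) (fun z hz => hz.1.1) (fun z hz => hz.1.1) hr hH
        hord he (-d) ?_
      rintro z ⟨⟨hzK, hzS⟩, hz1, hz2⟩ j hj1 hj2
      obtain ⟨hd1, hd2⟩ := hjd j hj1 hj2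
      push_cast at hz2
      rw [smul_smul]
      refine ⟨⟨?_, hSe z hzS _⟩, ?_⟩
      -- The translate lies between z and the core point of its line with φ = a, hence in K by
      -- convexity.
      · refine add_smul_mem_of_mem_Icc hK (hcore z hzS (a - φ z) ⟨by linarith, by linarith⟩)
          (t := 0) (by simpa using hzK) ⟨by linarith, by linarith⟩
      · rw [hφe]
        exact ⟨by linarith, by linarith⟩
    have hleft : lpMod p μ {z | (z ∈ K ∧ z ∈ S) ∧
        φ z ∈ Icc (a - (n + 1 : ℕ) * d) (a - n * d)} H ≤
        η + extConst p r * lpMod p μ Z H := by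
      refine lpMod_le_of_orderBound hp (hmeas _ _) (fun z hz => hz.1.1) (fun z hz => hz.1.1) hr hH
        hord he d ?_
      rintro z ⟨⟨hzK, hzS⟩, hz1, hz2⟩ j hj1 hj2
      obtain ⟨hd1, hd2⟩ := hjd j hj1 hj2
      push_cast at hz1
      rw [smul_smul]
      refine ⟨⟨?_, hSe z hzS _⟩, ?_⟩
      · refine add_smul_mem_of_mem_Icc hK (s := 0) (by simpa using hzK)
          (hcore z hzS (a + r * d - φ z) ⟨by linarith, by linarith⟩) ⟨by linarith, by linarith⟩
      · rw [hφe]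
        exact ⟨by linarith, by linarith⟩
    have hcover : {z | (z ∈ K ∧ z ∈ S) ∧
        φ z ∈ Icc (a - (n + 1 : ℕ) * d) (a + r * d + (n + 1 : ℕ) * d)} ⊆
        Z ∪ ({z | (z ∈ K ∧ z ∈ S) ∧
          φ z ∈ Icc (a + r * d + n * d) (a + r * d + (n + 1 : ℕ) * d)} ∪
        {z | (z ∈ K ∧ z ∈ S) ∧ φ z ∈ Icc (a - (n + 1 : ℕ) * d) (a - n * d)}) := by
      rintro z ⟨hz, hz1, hz2⟩
      rcases le_total (φ z) (a - n * d) with h1 | h1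
      · exact Or.inr (Or.inr ⟨hz, hz1, h1⟩)
      · rcases le_total (φ z) (a + r * d + n * d) with h2 | h2
        · exact Or.inl ⟨hz, h1, h2⟩
        · exact Or.inr (Or.inl ⟨hz, h2, hz2⟩)
    have hbound : η + extConst p r * lpMod p μ Z H ≤ ((1 + extConst p r * C : ℝ≥0) : ℝ≥0∞) * η := by
      push_cast
      rw [add_mul, one_mul, mul_assoc]
      gcongr
    refine (lpMod_mono hcover).trans ((lpMod_union_le (hmeas _ _)
      ((hmeas _ _).union (hmeas _ _)) hH).trans ?_)
    rw [ENNReal.coe_add, add_mul, ENNReal.coe_add, add_mul]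
    exact add_le_add hZ ((lpMod_union_le (hmeas _ _) (hmeas _ _) hH).trans
      (add_le_add (hright.trans hbound) (hleft.trans hbound)))

end Extension

/-! ### From the square to the whole body in adapted coordinates -/

section CrossBody

/-- A convex body in coordinates adapted to a pair of crossing chords that span its full width in
both coordinate directions. -/
structure IsCrossBody (K : Set (ℝ × ℝ)) (ρ : ℝ) : Prop where
  convex : Convex ℝ K
  isCompact : IsCompact K
  abs_fst_le : ∀ z ∈ K, |z.1| ≤ ρ
  abs_snd_le : ∀ z ∈ K, |z.2| ≤ ρ
  right_mem : (ρ, 0) ∈ K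
  top_mem : (0, ρ) ∈ K
  fst_mem : ∀ z ∈ K, (z.1, 0) ∈ K
  snd_mem : ∀ z ∈ K, (0, z.2) ∈ K

variable {K : Set (ℝ × ℝ)} {ρ : ℝ}

lemma mem_of_mem_Icc_fst (hK : Convex ℝ K) {x₁ x₂ x y : ℝ} (h₁ : (x₁, y) ∈ K) (h₂ : (x₂, y) ∈ K)
    (hx : x ∈ Icc x₁ x₂) : (x, y) ∈ K := by
  have := add_smul_mem_of_mem_Icc hK (z := (0, y)) (e := (1, 0)) (s := x₁) (t := x₂) (u := x)
    (by simpa using h₁) (by simpa using h₂) hx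
  simpa using this

lemma mem_of_mem_Icc_snd (hK : Convex ℝ K) {x y₁ y₂ y : ℝ} (h₁ : (x, y₁) ∈ K) (h₂ : (x, y₂) ∈ K)
    (hy : y ∈ Icc y₁ y₂) : (x, y) ∈ K := by
  have := add_smul_mem_of_mem_Icc hK (z := (x, 0)) (e := (0, 1)) (s := y₁) (t := y₂) (u := y)
    (by simpa using h₁) (by simpa using h₂) hy
  simpa using this

lemma IsCrossBody.zero_mem (h : IsCrossBody K ρ) : (0, 0) ∈ K := h.fst_mem _ h.top_mem

lemma IsCrossBody.half_mem (h : IsCrossBody K ρ) {a : ℝ} (ha : (a, 0) ∈ K) :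
    (a / 2, ρ / 2) ∈ K := by
  have := h.convex ha h.top_mem (show (0 : ℝ) ≤ 1 / 2 by norm_num)
    (show (0 : ℝ) ≤ 1 / 2 by norm_num) (by norm_num)
  convert this using 1
  ext <;> simp <;> ring

/-- The far corner is the midpoint of (ρ, 0) and (0, ρ), and the axis projections supply the other
corners. -/
lemma IsCrossBody.box_subset (h : IsCrossBody K ρ) : box (ρ / 2) ⊆ K := by
  rintro ⟨x, y⟩ ⟨⟨hx0, hx⟩, hy0, hy⟩
  dsimp only at hx0 hx hy0 hy
  have h1 : (ρ / 2, ρ / 2) ∈ K := h.half_mem h.right_mem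
  have h2 : (0, ρ / 2) ∈ K := h.snd_mem _ h1
  have h3 : (ρ / 2, 0) ∈ K := h.fst_mem _ h1
  exact mem_of_mem_Icc_snd h.convex
    (mem_of_mem_Icc_fst h.convex h.zero_mem h3 ⟨hx0, hx⟩)
    (mem_of_mem_Icc_fst h.convex h2 h1 ⟨hx0, hx⟩) ⟨hy0, hy⟩

lemma IsCrossBody.exists_left (h : IsCrossBody K ρ) :
    ∃ a ≤ 0, (a, 0) ∈ K ∧ ∀ z ∈ K, a ≤ z.1 := by
  obtain ⟨z, hz, hmin⟩ := h.isCompact.exists_isMinOn ⟨_, h.zero_mem⟩ continuous_fst.continuousOn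
  exact ⟨z.1, hmin h.zero_mem, h.fst_mem z hz, fun w hw => hmin hw⟩

variable {r : ℕ} {p : ℝ≥0∞}

/-- Three rounds of extension suffice. The unit square gives the horizontal and vertical strips of
width 1. These give the vertical lines through K that meet both heights 0 and 1, and likewise the
horizontal ones. The points still missing have both coordinates negative and lie near the left end;
they are reached horizontally from the region just covered. -/
lemma exists_lpMod_crossBody_le (hp : 0 < p) (hr : 1 ≤ r) (C₀ : ℝ≥0) (R : ℕ) (hR : 2 ≤ R) :
    ∃ C : ℝ≥0, ∀ (μ : Measure (ℝ × ℝ)) [μ.IsAddLeftInvariant] (K : Set (ℝ × ℝ)),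
      IsCrossBody K R → ∀ (H : ℝ × ℝ → ℝ), Measurable H → ∀ η : ℝ≥0∞,
      OrderBound p μ r K H η → lpMod p μ (box 1) H ≤ C₀ * η → lpMod p μ K H ≤ C * η := by
  obtain ⟨C₁, h₁⟩ := exists_lpMod_strip_le hp hr C₀ R
  obtain ⟨C₂, h₂⟩ := exists_lpMod_strip_le hp hr C₁ R
  obtain ⟨C₃, h₃⟩ := exists_lpMod_strip_le hp hr C₂ R
  refine ⟨C₁ + C₁ + C₂ + C₂ + C₃, fun μ _ K hKc H hH η hord hbox => ?_⟩
  have hK := hKc.convex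
  have hKm : MeasurableSet K := hKc.isCompact.measurableSet
  have hR' : (2 : ℝ) ≤ R := by exact_mod_cast hR
  obtain ⟨a, ha0, haK, hamin⟩ := hKc.exists_left
  have hbox1 : box 1 ⊆ K := (box_mono (by linarith)).trans hKc.box_subset
  have hfst : ∀ (z : ℝ × ℝ) (t : ℝ), (z + t • ((1, 0) : ℝ × ℝ)).1 = z.1 + t := by simp
  have hsnd : ∀ (z : ℝ × ℝ) (t : ℝ), (z + t • ((0, 1) : ℝ × ℝ)).2 = z.2 + t := by simp
  have hfst' : ∀ z ∈ K, z.1 ∈ Icc (0 - (R : ℝ) * 1) (0 + 1 + R * 1) := fun z hz => by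
    have := abs_le.1 (hKc.abs_fst_le z hz)
    exact ⟨by linarith, by linarith⟩
  have hsnd' : ∀ z ∈ K, z.2 ∈ Icc (0 - (R : ℝ) * 1) (0 + 1 + R * 1) := fun z hz => by
    have := abs_le.1 (hKc.abs_snd_le z hz)
    exact ⟨by linarith, by linarith⟩
  have hA₁ : lpMod p μ {z | z ∈ K ∧ z.2 ∈ Icc 0 1} H ≤ C₁ * η := by
    refine (lpMod_mono ?_).trans (h₁ μ K hK hKm H hH η hord (1, 0) (by simp) Prod.fst measurable_fst
      hfst {z | z.2 ∈ Icc 0 1} (measurable_snd measurableSet_Icc) (by simp) 0 1 zero_le_one ?_ ?_)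
    · exact fun z hz => ⟨hz, hfst' z hz.1⟩
    · rintro z hz hz'
      rw [zero_add] at hz'
      exact hbox1 ⟨hz', hz⟩
    · refine (lpMod_mono ?_).trans hbox
      rintro z ⟨hz, hz'⟩
      rw [zero_add] at hz'
      exact ⟨hz', hz⟩
  have hA₂ : lpMod p μ {z | z ∈ K ∧ z.1 ∈ Icc 0 1} H ≤ C₁ * η := by
    refine (lpMod_mono ?_).trans (h₁ μ K hK hKm H hH η hord (0, 1) (by simp) Prod.snd measurable_snd
      hsnd {z | z.1 ∈ Icc 0 1} (measurable_fst measurableSet_Icc) (by simp) 0 1 zero_le_one ?_ ?_)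
    · exact fun z hz => ⟨hz, hsnd' z hz.1⟩
    · rintro z hz hz'
      rw [zero_add] at hz'
      exact hbox1 ⟨hz, hz'⟩
    · refine (lpMod_mono ?_).trans hbox
      rintro z ⟨hz, hz'⟩
      rw [zero_add] at hz'
      exact ⟨hz, hz'⟩
  have hmx : ∀ y : ℝ, MeasurableSet {z : ℝ × ℝ | (z.1, y) ∈ K} := fun y =>
    (measurable_fst.prodMk measurable_const) hKm
  have hmy : ∀ x : ℝ, MeasurableSet {z : ℝ × ℝ | (x, z.2) ∈ K} := fun x =>
    (measurable_const.prodMk measurable_snd) hKm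
  have hB₁ : lpMod p μ {z | z ∈ K ∧ ((z.1, 0) ∈ K ∧ (z.1, 1) ∈ K)} H ≤ C₂ * η := by
    have hsub : ∀ z : ℝ × ℝ, ((z.1, 0) ∈ K ∧ (z.1, 1) ∈ K) → z.2 ∈ Icc (0 : ℝ) (0 + 1) → z ∈ K :=
      fun z hz hz' => mem_of_mem_Icc_snd hK hz.1 hz.2 (by simpa using hz')
    refine (lpMod_mono ?_).trans (h₂ μ K hK hKm H hH η hord (0, 1) (by simp) Prod.snd measurable_snd
      hsnd {z | (z.1, 0) ∈ K ∧ (z.1, 1) ∈ K} ((hmx 0).inter (hmx 1)) (by simp) 0 1 zero_le_one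
      hsub ?_)
    · exact fun z hz => ⟨hz, hsnd' z hz.1⟩
    · refine (lpMod_mono ?_).trans hA₁
      exact fun z hz => ⟨hsub z hz.1 hz.2, by simpa using hz.2⟩
  have hB₂ : lpMod p μ {z | z ∈ K ∧ ((0, z.2) ∈ K ∧ (1, z.2) ∈ K)} H ≤ C₂ * η := by
    have hsub : ∀ z : ℝ × ℝ, ((0, z.2) ∈ K ∧ (1, z.2) ∈ K) → z.1 ∈ Icc (0 : ℝ) (0 + 1) → z ∈ K :=
      fun z hz hz' => mem_of_mem_Icc_fst hK hz.1 hz.2 (by simpa using hz')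
    refine (lpMod_mono ?_).trans (h₂ μ K hK hKm H hH η hord (1, 0) (by simp) Prod.fst measurable_fst
      hfst {z | (0, z.2) ∈ K ∧ (1, z.2) ∈ K} ((hmy 0).inter (hmy 1)) (by simp) 0 1 zero_le_one
      hsub ?_)
    · exact fun z hz => ⟨hz, hfst' z hz.1⟩
    · refine (lpMod_mono ?_).trans hA₂
      exact fun z hz => ⟨hsub z hz.1 hz.2, by simpa using hz.2⟩
  -- The midpoint (a / 2, R / 2) of (a, 0) and (0, R) has height at least 1 because R ≥ 2; so the
  -- left half of the horizontal chord needs to be treated only beyond a / 2.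
  have htop : ∀ x ∈ Icc (a / 2) 0, (x, 1) ∈ K := by
    intro x hx
    have h1 : (a / 2, (R : ℝ) / 2) ∈ K := hKc.half_mem haK
    have h2 : (a / 2, (1 : ℝ)) ∈ K :=
      mem_of_mem_Icc_snd hK (hKc.fst_mem _ h1) h1 ⟨zero_le_one, by linarith⟩
    exact mem_of_mem_Icc_fst hK h2 (hKc.snd_mem _ h2) hx
  -- The core [a / 2, 0] is as long as the distance left to a. It may be arbitrarily short, which is
  -- where independence of the core length is needed.
  have hB₃ : lpMod p μ {z | z ∈ K ∧ ((0, z.2) ∈ K ∧ (a / 2, z.2) ∈ K) ∧ z.1 ≤ 0} H ≤ C₃ * η := by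
    have hsub : ∀ z : ℝ × ℝ, ((0, z.2) ∈ K ∧ (a / 2, z.2) ∈ K) →
        z.1 ∈ Icc (a / 2) (a / 2 + -a / 2) → z ∈ K :=
      fun z hz hz' => mem_of_mem_Icc_fst hK hz.2 hz.1 ⟨hz'.1, by linarith [hz'.2]⟩
    refine (lpMod_mono ?_).trans (h₃ μ K hK hKm H hH η hord (1, 0) (by simp) Prod.fst measurable_fst
      hfst {z | (0, z.2) ∈ K ∧ (a / 2, z.2) ∈ K} ((hmy 0).inter (hmy _)) (by simp) (a / 2) (-a / 2)
      (by linarith) hsub ?_)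
    · intro z hz
      have := hamin z hz.1
      exact ⟨⟨hz.1, hz.2.1⟩, by nlinarith, by nlinarith [hz.2.2]⟩
    · refine (lpMod_mono ?_).trans hB₁
      intro z hz
      have hzK := hsub z hz.1 hz.2
      exact ⟨hzK, hKc.fst_mem z hzK, htop _ ⟨hz.2.1, by linarith [hz.2.2]⟩⟩
  have hcover : K ⊆ {z | z ∈ K ∧ z.2 ∈ Icc 0 1} ∪ {z | z ∈ K ∧ z.1 ∈ Icc 0 1} ∪
      {z | z ∈ K ∧ ((z.1, 0) ∈ K ∧ (z.1, 1) ∈ K)} ∪ {z | z ∈ K ∧ ((0, z.2) ∈ K ∧ (1, z.2) ∈ K)} ∪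
      {z | z ∈ K ∧ ((0, z.2) ∈ K ∧ (a / 2, z.2) ∈ K) ∧ z.1 ≤ 0} := by
    intro z hz
    have hz1 := hKc.fst_mem z hz
    have hz2 := hKc.snd_mem z hz
    rcases le_total 0 z.2 with hy | hy
    · rcases le_total z.2 1 with hy1 | hy1
      · exact Or.inl (Or.inl (Or.inl (Or.inl ⟨hz, hy, hy1⟩)))
      · exact Or.inl (Or.inl (Or.inr
          ⟨hz, hz1, mem_of_mem_Icc_snd hK hz1 (y₂ := z.2) hz ⟨zero_le_one, hy1⟩⟩))
    rcases le_total 0 z.1 with hx | hx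
    · rcases le_total z.1 1 with hx1 | hx1
      · exact Or.inl (Or.inl (Or.inl (Or.inr ⟨hz, hx, hx1⟩)))
      · exact Or.inl (Or.inr
          ⟨hz, hz2, mem_of_mem_Icc_fst hK hz2 (x₂ := z.1) hz ⟨zero_le_one, hx1⟩⟩)
    rcases le_total (a / 2) z.1 with hxa | hxa
    · exact Or.inl (Or.inl (Or.inr ⟨hz, hz1, htop _ ⟨hxa, hx⟩⟩))
    · exact Or.inr ⟨hz, ⟨hz2, mem_of_mem_Icc_fst hK (x₁ := z.1) hz hz2 ⟨hxa, by linarith⟩⟩, hx⟩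
  have m1 : MeasurableSet {z : ℝ × ℝ | z ∈ K ∧ z.2 ∈ Icc 0 1} :=
    hKm.inter (measurable_snd measurableSet_Icc)
  have m2 : MeasurableSet {z : ℝ × ℝ | z ∈ K ∧ z.1 ∈ Icc 0 1} :=
    hKm.inter (measurable_fst measurableSet_Icc)
  have m3 : MeasurableSet {z : ℝ × ℝ | z ∈ K ∧ ((z.1, 0) ∈ K ∧ (z.1, 1) ∈ K)} :=
    hKm.inter ((hmx 0).inter (hmx 1))
  have m4 : MeasurableSet {z : ℝ × ℝ | z ∈ K ∧ ((0, z.2) ∈ K ∧ (1, z.2) ∈ K)} :=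
    hKm.inter ((hmy 0).inter (hmy 1))
  have m5 : MeasurableSet {z : ℝ × ℝ | z ∈ K ∧ ((0, z.2) ∈ K ∧ (a / 2, z.2) ∈ K) ∧ z.1 ≤ 0} :=
    hKm.inter (((hmy 0).inter (hmy _)).inter (measurable_fst measurableSet_Iic))
  refine (lpMod_mono hcover).trans ?_
  simp only [ENNReal.coe_add, add_mul]
  refine (lpMod_union_le (((m1.union m2).union m3).union m4) m5 hH).trans (add_le_add ?_ hB₃)
  refine (lpMod_union_le ((m1.union m2).union m3) m4 hH).trans (add_le_add ?_ hB₂)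
  refine (lpMod_union_le (m1.union m2) m3 hH).trans (add_le_add ?_ hB₁)
  exact (lpMod_union_le m1 m2 hH).trans (add_le_add hA₁ hA₂)

/-- The Whitney inequality for a convex body in adapted coordinates. -/
lemma exists_poly_near_crossBody (hp : 0 < p) (hr : 1 ≤ r) :
    ∃ C : ℝ≥0, ∃ R : ℕ, 2 ≤ R ∧ ∀ (μ : Measure (ℝ × ℝ)) [μ.IsAddHaarMeasure] (K : Set (ℝ × ℝ)),
      IsCrossBody K R → ∀ (F : ℝ × ℝ → ℝ), Measurable F → (∀ L, lpMod p μ (box L) F ≠ ∞) →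
      ∀ η : ℝ≥0∞, OrderBound p μ r K F η →
        ∃ q ∈ polySpace r, lpMod p μ K (fun x => F x - q x) ≤ C * η := by
  obtain ⟨C₀, m, h₀⟩ := exists_poly_near hp hr
  obtain ⟨C, hC⟩ := exists_lpMod_crossBody_le hp hr C₀ (2 * (m + r)) (by omega)
  -- K contains the square of side R / 2 = m + r, which leaves room for r steps of length at most 1
  -- from any point of the square of side m.
  refine ⟨C, 2 * (m + r), by omega, fun μ _ K hK F hF hfin η hord => ?_⟩
  have hbox : box (m + r) ⊆ K := (box_mono (by push_cast; linarith)).trans hK.box_subset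
  obtain ⟨q, hq, hqle⟩ := h₀ μ F hF hfin η fun e he u hu => by
    refine (lpMod_mono ?_).trans (hord e he u)
    have hstep : IsStep e := by
      rcases he with rfl | rfl
      · exact isStep_fst
      · exact isStep_snd
    intro z hz
    refine ⟨hbox (box_mono (by simp) hz), hbox ?_⟩
    rw [Nat.cast_smul_eq_nsmul]
    exact (hstep.smul hu).add_nsmul_mem_box hz r
  refine ⟨q, hq, hC μ K hK (fun x => F x - q x) (hF.sub (continuous_of_mem_polySpace hq).measurable) η ?_ hqle⟩
  intro e he u
  rw [fwdDiff_iter_sub_of_mem_polySpace hq he]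
  exact hord e he u

end CrossBody

/-! ### Extremal crossing chords -/

section Geometry

/-- The determinant of a pair of plane vectors. -/
def planeDet (v w : EuclideanSpace ℝ (Fin 2)) : ℝ := v 0 * w 1 - v 1 * w 0

/-- ζ leads from s₀ to the farther endpoint of [0, 1]. Used as the unit of length, it makes all
coordinates at most 1 in absolute value. -/
lemma exists_abs_sub_le_of_mem_Icc (s₀ : ℝ) :
    ∃ ζ : ℝ, ζ ≠ 0 ∧ s₀ + ζ ∈ Icc (0 : ℝ) 1 ∧ ∀ s ∈ Icc (0 : ℝ) 1, |s - s₀| ≤ |ζ| := by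
  rcases le_or_gt s₀ (1 / 2) with h1 | h1
  · refine ⟨1 - s₀, by linarith, by simp, fun s hs => ?_⟩
    rw [abs_of_pos (show 0 < 1 - s₀ by linarith), abs_le]
    constructor <;> linarith [hs.1, hs.2]
  · refine ⟨-s₀, by linarith, by simp, fun s hs => ?_⟩
    rw [abs_neg, abs_of_pos (show 0 < s₀ by linarith), abs_le]
    constructor <;> linarith [hs.1, hs.2]

lemma exists_planeDet_pos {G : Set (EuclideanSpace ℝ (Fin 2))} (hG : (interior G).Nonempty) :
    ∃ P ∈ G, ∃ R ∈ G, ∃ Q ∈ G, ∃ S ∈ G, 0 < planeDet (P - R) (Q - S) := by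
  obtain ⟨x, hx⟩ := hG
  obtain ⟨ε, hε, hball⟩ := Metric.isOpen_iff.1 isOpen_interior x hx
  have hmem : ∀ i : Fin 2, x + (ε / 2) • EuclideanSpace.single i (1 : ℝ) ∈ G := by
    intro i
    refine interior_subset (hball ?_)
    rw [Metric.mem_ball, dist_eq_norm, add_sub_cancel_left, norm_smul, PiLp.norm_single]
    simp only [norm_one, mul_one, Real.norm_eq_abs]
    rw [abs_of_pos (by positivity)]
    linarith
  have hxG := interior_subset hx
  refine ⟨_, hmem 0, x, hxG, _, hmem 1, x, hxG, ?_⟩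
  simp [planeDet]
  positivity

/-- Every planar convex body has a pair of crossing chords spanning its full width in the
directions of each other. -/
lemma exists_crossing_chords {G : Set (EuclideanSpace ℝ (Fin 2))} (hconv : Convex ℝ G)
    (hcomp : IsCompact G) (hint : (interior G).Nonempty) :
    ∃ O e₁ e₂ : EuclideanSpace ℝ (Fin 2), LinearIndependent ℝ ![e₁, e₂] ∧
      O + e₁ ∈ G ∧ O + e₂ ∈ G ∧ ∀ s t : ℝ, O + s • e₁ + t • e₂ ∈ G →
        |s| ≤ 1 ∧ |t| ≤ 1 ∧ O + s • e₁ ∈ G ∧ O + t • e₂ ∈ G := by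
  obtain ⟨P₀, hP₀, R₀, hR₀, Q₀, hQ₀, S₀, hS₀, hpos⟩ := exists_planeDet_pos hint
  -- The maximum runs over all four endpoints independently, so each can be replaced by an arbitrary
  -- point X of G.
  obtain ⟨⟨P, R, Q, S⟩, ⟨hP, hR, hQ, hS⟩, hmax⟩ :=
    (hcomp.prod (hcomp.prod (hcomp.prod hcomp))).exists_isMaxOn ⟨(P₀, R₀, Q₀, S₀), hP₀, hR₀, hQ₀, hS₀⟩
      (f := fun x => planeDet (x.1 - x.2.1) (x.2.2.1 - x.2.2.2))
      (by unfold planeDet; fun_prop)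
  have hmax' : ∀ P' ∈ G, ∀ R' ∈ G, ∀ Q' ∈ G, ∀ S' ∈ G,
      planeDet (P' - R') (Q' - S') ≤ planeDet (P - R) (Q - S) :=
    fun P' hP' R' hR' Q' hQ' S' hS' =>
      hmax (a := (P', R', Q', S')) ⟨hP', hR', hQ', hS'⟩
  dsimp only at hP hR hQ hS
  have hD : 0 < planeDet (P - R) (Q - S) :=
    hpos.trans_le (hmax' _ hP₀ _ hR₀ _ hQ₀ _ hS₀)
  set v := P - R with hv
  set w := Q - S with hw
  set D := planeDet v w with hDdef
  -- Replacing P by X gives the upper bound. Replacing R by X gives the lower one, since the two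
  -- determinants add up to D.
  have hs : ∀ X ∈ G, planeDet (X - R) w / D ∈ Icc (0 : ℝ) 1 := by
    intro X hX
    have h1 := hmax' X hX R hR Q hQ S hS
    have h2 := hmax' P hP X hX Q hQ S hS
    have h3 : planeDet (X - R) w + planeDet (P - X) w = D := by
      simp [planeDet, hDdef, hv]
      ring
    exact ⟨div_nonneg (by linarith) hD.le, (div_le_one hD).2 h1⟩
  have ht : ∀ X ∈ G, planeDet v (X - S) / D ∈ Icc (0 : ℝ) 1 := by
    intro X hX
    have h1 := hmax' P hP R hR X hX S hS
    have h2 := hmax' P hP R hR Q hQ X hX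
    have h3 : planeDet v (X - S) + planeDet v (Q - X) = D := by
      simp [planeDet, hDdef, hw]
      ring
    exact ⟨div_nonneg (by linarith) hD.le, (div_le_one hD).2 h1⟩
  set s₀ := planeDet (S - R) w / D with hs₀
  set t₀ := planeDet v (R - S) / D with ht₀
  obtain ⟨ζ₁, hζ₁, hζ₁', hζ₁''⟩ := exists_abs_sub_le_of_mem_Icc s₀
  obtain ⟨ζ₂, hζ₂, hζ₂', hζ₂''⟩ := exists_abs_sub_le_of_mem_Icc t₀
  -- s₀ is the first coordinate of S and t₀ the second coordinate of R, so both sides are the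
  -- intersection of the lines RP and SQ.
  have hO : R + s₀ • v = S + t₀ • w := by
    have hD' : planeDet v w ≠ 0 := hD.ne'
    ext i
    fin_cases i
    · simp only [hs₀, ht₀, hDdef, PiLp.add_apply, PiLp.smul_apply, smul_eq_mul, Fin.zero_eta]
      field_simp
      simp only [planeDet, PiLp.sub_apply]
      ring
    · simp only [hs₀, ht₀, hDdef, PiLp.add_apply, PiLp.smul_apply, smul_eq_mul, Fin.mk_one]
      field_simp
      simp only [planeDet, PiLp.sub_apply]
      ring
  have hRP : ∀ s ∈ Icc (0 : ℝ) 1, R + s • v ∈ G := fun s hs =>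
    hconv.add_smul_sub_mem hR hP hs
  have hSQ : ∀ t ∈ Icc (0 : ℝ) 1, S + t • w ∈ G := fun t ht =>
    hconv.add_smul_sub_mem hS hQ ht
  have h₁ : ∀ s : ℝ, R + s₀ • v + s • (ζ₁ • v) = R + (s₀ + s * ζ₁) • v := fun s => by module
  have h₂ : ∀ t : ℝ, R + s₀ • v + t • (ζ₂ • w) = S + (t₀ + t * ζ₂) • w := fun t => by
    rw [hO]
    module
  refine ⟨R + s₀ • v, ζ₁ • v, ζ₂ • w, ?_, ?_, ?_, ?_⟩
  · rw [LinearIndependent.pair_iff]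
    intro a b hab
    have e1 : planeDet (a • (ζ₁ • v) + b • (ζ₂ • w)) w = a * ζ₁ * D := by
      simp [planeDet, hDdef]
      ring
    have e2 : planeDet v (a • (ζ₁ • v) + b • (ζ₂ • w)) = b * ζ₂ * D := by
      simp [planeDet, hDdef]
      ring
    rw [hab] at e1 e2
    have z1 : planeDet 0 w = 0 := by simp [planeDet]
    have z2 : planeDet v 0 = 0 := by simp [planeDet]
    rw [z1] at e1
    rw [z2] at e2
    constructor
    · simpa [hζ₁, hD.ne'] using e1.symm
    · simpa [hζ₂, hD.ne'] using e2.symm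
  · have := h₁ 1
    rw [one_smul, one_mul] at this
    rw [this]
    exact hRP _ hζ₁'
  · have := h₂ 1
    rw [one_smul, one_mul] at this
    rw [this]
    exact hSQ _ hζ₂'
  · intro s t hX
    have e1 : planeDet (R + s₀ • v + s • (ζ₁ • v) + t • (ζ₂ • w) - R) w / D = s₀ + s * ζ₁ := by
      rw [div_eq_iff hD.ne']
      simp [planeDet, hDdef]
      ring
    have e2 : planeDet v (R + s₀ • v + s • (ζ₁ • v) + t • (ζ₂ • w) - S) / D = t₀ + t * ζ₂ := by
      rw [div_eq_iff hD.ne', hO]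
      simp [planeDet, hDdef]
      ring
    have m1 := hs _ hX
    have m2 := ht _ hX
    rw [e1] at m1
    rw [e2] at m2
    refine ⟨?_, ?_, ?_, ?_⟩
    · have := hζ₁'' _ m1
      rw [add_sub_cancel_left, abs_mul] at this
      exact le_of_mul_le_mul_right (by linarith) (abs_pos.2 hζ₁)
    · have := hζ₂'' _ m2
      rw [add_sub_cancel_left, abs_mul] at this
      exact le_of_mul_le_mul_right (by linarith) (abs_pos.2 hζ₂)
    · rw [h₁]
      exact hRP _ m1
    · rw [h₂]
      exact hSQ _ m2

end Geometry

/-! ### Affine coordinates along the chords -/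

section Coordinates

variable {E : Type*} [NormedAddCommGroup E] [NormedSpace ℝ E]

lemma exists_coordinates [FiniteDimensional ℝ E] (hE : Module.finrank ℝ E = 2) {e₁ e₂ : E}
    (h : LinearIndependent ℝ ![e₁, e₂]) :
    ∃ Λ : (ℝ × ℝ) ≃L[ℝ] E, ∀ z, Λ z = z.1 • e₁ + z.2 • e₂ := by
  set f : (ℝ × ℝ) →ₗ[ℝ] E := (LinearMap.fst ℝ ℝ ℝ).smulRight e₁ + (LinearMap.snd ℝ ℝ ℝ).smulRight e₂
    with hf
  have hinj : Function.Injective f := by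
    rw [← LinearMap.ker_eq_bot, LinearMap.ker_eq_bot']
    intro z hz
    have := LinearIndependent.pair_iff.1 h z.1 z.2 (by simpa [hf] using hz)
    exact Prod.ext this.1 this.2
  refine ⟨(LinearEquiv.ofInjectiveOfFinrankEq f hinj (by simp [hE])).toContinuousLinearEquiv,
    fun z => ?_⟩
  change f z = _
  simp [hf]

lemma isCrossBody_preimage {G : Set E} (hconv : Convex ℝ G) (hcomp : IsCompact G) {O e₁ e₂ : E}
    (h₁ : O + e₁ ∈ G) (h₂ : O + e₂ ∈ G) (h : ∀ s t : ℝ, O + s • e₁ + t • e₂ ∈ G →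
        |s| ≤ 1 ∧ |t| ≤ 1 ∧ O + s • e₁ ∈ G ∧ O + t • e₂ ∈ G) {ρ : ℝ} (hρ : 0 < ρ)
    (Λ : (ℝ × ℝ) ≃L[ℝ] E) (hΛ : ∀ z, Λ z = z.1 • (ρ⁻¹ • e₁) + z.2 • (ρ⁻¹ • e₂)) :
    IsCrossBody {z | O + Λ z ∈ G} ρ := by
  have hΛ' : ∀ z, O + Λ z = O + (z.1 * ρ⁻¹) • e₁ + (z.2 * ρ⁻¹) • e₂ := fun z => by
    rw [hΛ, smul_smul, smul_smul, add_assoc]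
  have habs : ∀ x : ℝ, |x * ρ⁻¹| ≤ 1 → |x| ≤ ρ := fun x hx => by
    rwa [abs_mul, abs_of_pos (inv_pos.2 hρ), ← div_eq_mul_inv, div_le_one hρ] at hx
  refine ⟨?_, ?_, fun z hz => ?_, fun z hz => ?_, ?_, ?_, fun z hz => ?_, fun z hz => ?_⟩
  · intro z hz z' hz' a b ha hb hab
    have := hconv hz hz' ha hb hab
    have heq : a • (O + Λ z) + b • (O + Λ z') = O + Λ (a • z + b • z') := by
      rw [map_add, map_smul, map_smul]
      have : O = (a + b) • O := by rw [hab, one_smul]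
      conv_rhs => rw [this]
      module
    rwa [heq] at this
  · have : {z | O + Λ z ∈ G} = (Λ.toHomeomorph.trans (Homeomorph.addLeft O)) ⁻¹' G := rfl
    rw [this]
    exact (Homeomorph.isCompact_preimage _).2 hcomp
  · rw [mem_ofPred_eq, hΛ'] at hz
    exact habs _ (h _ _ hz).1
  · rw [mem_ofPred_eq, hΛ'] at hz
    exact habs _ (h _ _ hz).2.1
  · rw [mem_ofPred_eq, hΛ']
    simpa [hρ.ne'] using h₁
  · rw [mem_ofPred_eq, hΛ']
    simpa [hρ.ne'] using h₂
  · rw [mem_ofPred_eq, hΛ'] at hz ⊢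
    simpa using (h _ _ hz).2.2.1
  · rw [mem_ofPred_eq, hΛ'] at hz ⊢
    simpa using (h _ _ hz).2.2.2

end Coordinates

/-! ### Transfer between the plane and adapted coordinates -/

section Transfer

lemma fwdDiff_neg_iter {M : Type*} [AddCommGroup M] (h : M) (r : ℕ) (H : M → ℝ) (z : M) :
    (fwdDiff (-h))^[r] H z = (-1) ^ r * (fwdDiff h)^[r] H (z - r • h) := by
  induction r generalizing z with
  | zero => simp
  | succ r ih =>
    rw [Function.iterate_succ_apply', Function.iterate_succ_apply', fwdDiff, fwdDiff, ih, ih,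
      show z + -h - r • h = z - (r + 1) • h by rw [succ_nsmul]; abel,
      show z - (r + 1) • h + h = z - r • h by rw [succ_nsmul]; abel]
    ring

/-- The modulus sees only positive steps, but a difference with negative step is, up to sign, a
translate of one with positive step. Step 0 gives 0 because r ≥ 1. -/
lemma orderBound_of_pos {p : ℝ≥0∞} (hp : 0 < p) {μ : Measure (ℝ × ℝ)} [μ.IsAddLeftInvariant]
    {r : ℕ} (hr : 1 ≤ r) {K : Set (ℝ × ℝ)} (hK : MeasurableSet K) {H : ℝ × ℝ → ℝ}
    (hH : Measurable H) {η : ℝ≥0∞}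
    (h : ∀ e ∈ ({(1, 0), (0, 1)} : Set (ℝ × ℝ)), ∀ u : ℝ, 0 < u →
      lpMod p μ {z | z ∈ K ∧ z + (r : ℝ) • (u • e) ∈ K} ((fwdDiff (u • e))^[r] H) ≤ η) :
    OrderBound p μ r K H η := by
  intro e he u
  rcases lt_trichotomy u 0 with hu | rfl | hu
  · have hB : MeasurableSet {z | z ∈ K ∧ z + (r : ℝ) • ((-u) • e) ∈ K} :=
      hK.inter (measurable_id.add_const _ hK)
    have hid : (fwdDiff (u • e))^[r] H = fun z => (-1) ^ r *
        (fwdDiff ((-u) • e))^[r] H (z + (r : ℝ) • (u • e)) := by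
      funext z
      have := fwdDiff_neg_iter ((-u) • e) r H z
      rw [neg_smul, neg_neg] at this
      rw [this, neg_smul, smul_neg, sub_neg_eq_add, Nat.cast_smul_eq_nsmul]
    rw [hid, lpMod_const_mul]
    simp only [enorm_pow, enorm_neg, enorm_one, one_pow, ENNReal.one_rpow, one_mul]
    refine (lpMod_shift_le hB (measurable_fwdDiff_iter _ _ hH) _ ?_).trans (h e he (-u) (by linarith))
    rintro z ⟨hz, hz'⟩
    exact ⟨hz', by simpa using hz⟩
  · have : (fwdDiff ((0 : ℝ) • e))^[r] H = fun _ => 0 := by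
      obtain ⟨n, rfl⟩ := Nat.exists_eq_add_of_le' hr
      funext x
      rw [Function.iterate_succ_apply']
      simp [fwdDiff]
    rw [this, lpMod_zero hp]
    exact zero_le
  · exact h e he u hu

lemma finDiff_eq_fwdDiff_iter {d : ℕ} (r : ℕ) (h : EuclideanSpace ℝ (Fin d))
    (f : EuclideanSpace ℝ (Fin d) → ℝ) : finDiff r h f = (fwdDiff h)^[r] f := by
  funext x
  rw [fwdDiff_iter_eq_sum_shift, finDiff]
  refine Finset.sum_congr rfl fun j hj => ?_
  have hj' : j ≤ r := by
    have := Finset.mem_range.1 hj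
    omega
  have hsign : (-1 : ℝ) ^ (r + j) = (-1) ^ (r - j) := by
    rw [show r + j = (r - j) + 2 * j by omega, pow_add, pow_mul]
    simp
  rw [hsign, Nat.cast_smul_eq_nsmul]
  simp

lemma pNorm_eq_lpOn {d : ℕ} (p : ℝ≥0∞) (A : Set (EuclideanSpace ℝ (Fin d)))
    (g : EuclideanSpace ℝ (Fin d) → ℝ) : pNorm p A g = lpOn p volume A g := rfl

lemma fwdDiff_iter_comp_coordinates {d : ℕ} (Λ : (ℝ × ℝ) ≃L[ℝ] EuclideanSpace ℝ (Fin d))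
    (O : EuclideanSpace ℝ (Fin d)) (r : ℕ) (h : ℝ × ℝ) (f : EuclideanSpace ℝ (Fin d) → ℝ)
    (z : ℝ × ℝ) :
    (fwdDiff h)^[r] (fun z => f (O + Λ z)) z = (fwdDiff (Λ h))^[r] f (O + Λ z) := by
  simp only [fwdDiff_iter_eq_sum_shift, add_assoc, map_add, map_nsmul]

lemma lpMod_comp_coordinates {d : ℕ} (Λ : (ℝ × ℝ) ≃L[ℝ] EuclideanSpace ℝ (Fin d))
    (O : EuclideanSpace ℝ (Fin d)) (p : ℝ≥0∞) {A : Set (EuclideanSpace ℝ (Fin d))}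
    (hA : MeasurableSet A) {g : EuclideanSpace ℝ (Fin d) → ℝ} (hg : Measurable g) :
    lpMod p (Measure.map Λ.symm volume) {z | O + Λ z ∈ A} (fun z => g (O + Λ z)) =
      pNorm p A g ^ subExp p := by
  rw [lpMod, pNorm_eq_lpOn]
  congr 1
  unfold lpOn
  split_ifs with hp
  · apply le_antisymm
    · refine iSup₂_le fun z hz => ?_
      exact le_iSup₂ (f := fun x (_ : x ∈ A) => ‖g x‖ₑ) (O + Λ z) hz
    · refine iSup₂_le fun x hx => ?_
      have hxz : O + Λ (Λ.symm (x - O)) = x := by simp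
      refine le_trans ?_ (le_iSup₂ (f := fun z (_ : z ∈ {z | O + Λ z ∈ A}) => ‖g (O + Λ z)‖ₑ)
        (Λ.symm (x - O)) (by simpa using hx))
      rw [hxz]
  · have h1 : MeasurePreserving Λ (Measure.map Λ.symm volume) volume :=
      (MeasurableEquiv.measurePreserving_symm volume Λ.symm.toHomeomorph.toMeasurableEquiv)
    have h2 : MeasurePreserving (fun z => O + Λ z) (Measure.map Λ.symm volume) volume :=
      (measurePreserving_add_left volume O).comp h1
    exact eLpNorm_comp_measurePreserving hg.aestronglyMeasurable (h2.restrict_preimage hA)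

lemma pNorm_congr_ae {d : ℕ} {p : ℝ≥0∞} {A : Set (EuclideanSpace ℝ (Fin d))}
    {f g : EuclideanSpace ℝ (Fin d) → ℝ}
    (h : if p = ∞ then ∀ x ∈ A, f x = g x else ∀ᵐ x ∂volume.restrict A, f x = g x) :
    pNorm p A f = pNorm p A g := by
  unfold pNorm
  split_ifs at h ⊢ with hp
  · exact iSup_congr fun x => iSup_congr fun hx => by rw [h x hx]
  · exact eLpNorm_congr_ae h

lemma finDiffOn_congr {d : ℕ} {r : ℕ} {G : Set (EuclideanSpace ℝ (Fin d))}
    {f g : EuclideanSpace ℝ (Fin d) → ℝ} {h x : EuclideanSpace ℝ (Fin d)}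
    (hx : ∀ j : ℕ, x + (j : ℝ) • h ∈ G → f (x + (j : ℝ) • h) = g (x + (j : ℝ) • h)) :
    finDiffOn r h f G x = finDiffOn r h g G x := by
  unfold finDiffOn
  by_cases hmem : x ∈ {η | segment ℝ η (η + (r : ℝ) • h) ⊆ G}
  · rw [indicator_of_mem hmem, indicator_of_mem hmem]
    refine Finset.sum_congr rfl fun j hj => ?_
    rw [hx j]
    have hjr : (j : ℝ) ≤ r := by exact_mod_cast Nat.lt_succ_iff.1 (Finset.mem_range.1 hj)
    refine hmem ?_
    rcases Nat.eq_zero_or_pos r with rfl | hr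
    · have : j = 0 := by simpa using hj
      subst this
      simp
    · have hr' : (0 : ℝ) < r := by exact_mod_cast hr
      rw [segment_eq_image']
      refine ⟨j / r, ⟨by positivity, (div_le_one hr').2 hjr⟩, ?_⟩
      simp only [add_sub_cancel_left, smul_smul]
      rw [div_mul_cancel₀ _ hr'.ne']
  · rw [indicator_of_notMem hmem, indicator_of_notMem hmem]

/-- Every element of `L^p(G)` has a measurable representative that vanishes outside `G`. -/
lemma exists_measurable_representative {d : ℕ} {p : ℝ≥0∞} {G : Set (EuclideanSpace ℝ (Fin d))}
    (hG : IsCompact G) {f : EuclideanSpace ℝ (Fin d) → ℝ} (hf : MemSpace p G f) :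
    ∃ g : EuclideanSpace ℝ (Fin d) → ℝ, Measurable g ∧ pNorm p univ g ≠ ∞ ∧
      (∀ q : EuclideanSpace ℝ (Fin d) → ℝ,
        pNorm p G (fun x => f x - q x) = pNorm p G (fun x => g x - q x)) ∧
      ∀ (r : ℕ) (h : EuclideanSpace ℝ (Fin d)),
        pNorm p G (finDiffOn r h f G) = pNorm p G (finDiffOn r h g G) := by
  classical
  have hGm := hG.measurableSet
  by_cases hp : p = ∞
  · subst hp
    have hf' : ContinuousOn f G := by simpa [MemSpace] using hf
    have hfg : ∀ x ∈ G, f x = G.indicator f x := fun x hx => by simp [hx]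
    refine ⟨G.indicator f, ?_, ?_, fun q => ?_, fun r h => ?_⟩
    · have := hf'.measurable_piecewise (continuousOn_const (c := (0 : ℝ)) (s := Gᶜ)) hGm
      convert this using 1
      ext x
      by_cases hx : x ∈ G <;> simp [hx]
    · obtain ⟨M, hM⟩ := hG.exists_bound_of_continuousOn hf'
      refine ne_top_of_le_ne_top (b := ENNReal.ofReal M) ENNReal.ofReal_ne_top ?_
      simp only [pNorm, if_true]
      refine iSup₂_le fun x _ => ?_
      by_cases hx : x ∈ G
      · rw [indicator_of_mem hx, ← ofReal_norm]
        exact ENNReal.ofReal_le_ofReal (hM x hx)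
      · simp [hx]
    · refine pNorm_congr_ae ?_
      rw [if_pos rfl]
      exact fun x hx => by rw [hfg x hx]
    · refine pNorm_congr_ae ?_
      rw [if_pos rfl]
      exact fun x _ => finDiffOn_congr fun j hj => hfg _ hj
  · have hf' : MemLp f p (volume.restrict G) := by simpa [MemSpace, hp] using hf
    set g₀ := hf'.1.mk f with hg₀
    have hg₀m : Measurable g₀ := hf'.1.stronglyMeasurable_mk.measurable
    have hae : ∀ᵐ x ∂volume, x ∈ G → f x = g₀ x := (ae_restrict_iff' hGm).1 hf'.1.ae_eq_mk
    have hae' : ∀ᵐ x ∂volume, x ∈ G → f x = G.indicator g₀ x := by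
      filter_upwards [hae] with x hx hxG
      rw [indicator_of_mem hxG, hx hxG]
    refine ⟨G.indicator g₀, hg₀m.indicator hGm, ?_, fun q => ?_, fun r h => ?_⟩
    · simp only [pNorm, hp, if_false, Measure.restrict_univ]
      rw [eLpNorm_indicator_eq_eLpNorm_restrict hGm, ← eLpNorm_congr_ae hf'.1.ae_eq_mk]
      exact hf'.2.ne
    · refine pNorm_congr_ae ?_
      rw [if_neg hp, ae_restrict_iff' hGm]
      filter_upwards [hae'] with x hx hxG
      rw [hx hxG]
    · refine pNorm_congr_ae ?_
      rw [if_neg hp]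
      refine ae_restrict_of_ae ?_
      -- The differences sample f at translates, so the exceptional null set has to be translated
      -- too.
      have hall : ∀ j : ℕ, ∀ᵐ x ∂(volume : Measure (EuclideanSpace ℝ (Fin d))),
          x + (j : ℝ) • h ∈ G → f (x + (j : ℝ) • h) = G.indicator g₀ (x + (j : ℝ) • h) := fun j =>
        (measurePreserving_add_right volume ((j : ℝ) • h)).quasiMeasurePreserving.ae hae'
      filter_upwards [ae_all_iff.2 hall] with x hx
      exact finDiffOn_congr fun j hj => hx j hj

/-- A step whose r-fold multiple joins two points of G has length at most diam G, as r ≥ 1, so it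
takes part in the supremum; any other step has an empty domain. By convexity, having both endpoints
in G is the same as having the segment in G. -/
lemma lpMod_fwdDiff_iter_le_dirModulus {d : ℕ} (Λ : (ℝ × ℝ) ≃L[ℝ] EuclideanSpace ℝ (Fin d))
    (O : EuclideanSpace ℝ (Fin d)) {p : ℝ≥0∞} (hp : 0 < p) {r : ℕ} (hr : 1 ≤ r)
    {G : Set (EuclideanSpace ℝ (Fin d))} (hconv : Convex ℝ G) (hcomp : IsCompact G)
    {f : EuclideanSpace ℝ (Fin d) → ℝ} (hf : Measurable f) {Ξ : Set (EuclideanSpace ℝ (Fin d))}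
    {e : ℝ × ℝ} {ξ : EuclideanSpace ℝ (Fin d)} (hξ : ξ ∈ Ξ) (hnorm : ‖ξ‖ = 1) {c : ℝ} (hc : 0 < c)
    (he : Λ e = c • ξ) {u : ℝ} (hu : 0 < u) :
    lpMod p (Measure.map Λ.symm volume)
        {z | z ∈ {z | O + Λ z ∈ G} ∧ z + (r : ℝ) • (u • e) ∈ {z | O + Λ z ∈ G}}
        ((fwdDiff (u • e))^[r] fun z => f (O + Λ z)) ≤ dirModulus r f G Ξ p ^ subExp p := by
  have hGm := hcomp.measurableSet
  set h := (u * c) • ξ with hh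
  have hΛh : Λ (u • e) = h := by rw [map_smul, he, smul_smul]
  set A : Set (EuclideanSpace ℝ (Fin d)) := {x | x ∈ G ∧ x + (r : ℝ) • h ∈ G} with hA
  have hAm : MeasurableSet A := hGm.inter (measurable_id.add_const _ hGm)
  have hset : {z | z ∈ {z | O + Λ z ∈ G} ∧ z + (r : ℝ) • (u • e) ∈ {z | O + Λ z ∈ G}} =
      {z | O + Λ z ∈ A} := by
    ext z
    simp only [hA, mem_ofPred_eq, map_add, map_smul Λ (r : ℝ), hΛh, add_assoc]
  have hfun : ((fwdDiff (u • e))^[r] fun z => f (O + Λ z)) =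
      fun z => (fwdDiff h)^[r] f (O + Λ z) := by
    funext z
    rw [fwdDiff_iter_comp_coordinates, hΛh]
  rw [hset, hfun]
  rcases A.eq_empty_or_nonempty with hAe | ⟨x, hx⟩
  · have : {z | O + Λ z ∈ A} = ∅ := by simp [hAe]
    rw [this, lpMod_empty hp]
    exact zero_le
  rw [lpMod_comp_coordinates Λ O p hAm (measurable_fwdDiff_iter h r hf)]
  refine ENNReal.rpow_le_rpow ?_ (subExp_pos hp).le
  have hdiam : u * c ≤ Metric.diam G := by
    have h1 := Metric.dist_le_diam_of_mem hcomp.isBounded hx.2 hx.1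
    rw [dist_eq_norm, add_sub_cancel_left, hh, norm_smul, norm_smul, hnorm, mul_one,
      Real.norm_of_nonneg (by positivity), Real.norm_of_nonneg (by positivity)] at h1
    refine le_trans (le_mul_of_one_le_left (by positivity) (by exact_mod_cast hr)) h1
  have hle : pNorm p G (finDiffOn r h f G) ≤ dirModulus r f G Ξ p := by
    unfold dirModulus dirModulusAt
    exact le_iSup₂_of_le ξ hξ (le_iSup₂_of_le (u * c) ⟨by positivity, hdiam⟩ le_rfl)
  refine le_trans ?_ hle
  have hAG : A ⊆ G := fun x hx => hx.1
  have heq : ∀ x ∈ A, (fwdDiff h)^[r] f x = finDiffOn r h f G x := by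
    intro x hx
    have hmem : x ∈ {η | segment ℝ η (η + (r : ℝ) • h) ⊆ G} := hconv.segment_subset hx.1 hx.2
    rw [finDiffOn, indicator_of_mem hmem, finDiff_eq_fwdDiff_iter]
  have h1 : pNorm p A ((fwdDiff h)^[r] f) = pNorm p A (finDiffOn r h f G) := by
    refine pNorm_congr_ae ?_
    split_ifs
    · exact heq
    · exact (ae_restrict_iff' hAm).2 (Filter.Eventually.of_forall heq)
  rw [h1]
  unfold pNorm
  split_ifs
  · exact biSup_mono hAG
  · exact eLpNorm_mono_measure _ (Measure.restrict_mono hAG le_rfl)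

lemma exists_affine_mvPolynomial (ℓ : EuclideanSpace ℝ (Fin 2) →ₗ[ℝ] ℝ)
    (O : EuclideanSpace ℝ (Fin 2)) :
    ∃ P : MvPolynomial (Fin 2) ℝ, ∀ x : EuclideanSpace ℝ (Fin 2),
      MvPolynomial.eval x.ofLp P = ℓ (x - O) := by
  refine ⟨∑ i, MvPolynomial.C (ℓ (EuclideanSpace.single i 1)) * MvPolynomial.X i -
    MvPolynomial.C (ℓ O), fun x => ?_⟩
  have hx : x = ∑ i, x i • EuclideanSpace.single i (1 : ℝ) := by
    ext j
    fin_cases j <;> simp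
  rw [map_sub ℓ]
  conv_rhs => rw [hx]
  simp [mul_comm]

/-- Along a direction parallel to an axis one adapted coordinate is constant, so a monomial
restricts to a polynomial of degree < r. -/
lemma exists_dirPoly_of_mem_polySpace (Λ : (ℝ × ℝ) ≃L[ℝ] EuclideanSpace ℝ (Fin 2))
    (O : EuclideanSpace ℝ (Fin 2)) {Ξ : Set (EuclideanSpace ℝ (Fin 2))}
    (hΞ : ∀ ξ ∈ Ξ, (Λ.symm ξ).1 = 0 ∨ (Λ.symm ξ).2 = 0) {r : ℕ} {q : ℝ × ℝ → ℝ}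
    (hq : q ∈ polySpace r) :
    ∃ Q ∈ dirPoly 2 r Ξ, ∀ z, MvPolynomial.eval (O + Λ z).ofLp Q = q z := by
  induction hq using Submodule.span_induction with
  | mem q hq =>
    obtain ⟨i, hi, j, hj, rfl⟩ := hq
    obtain ⟨P₁, hP₁⟩ := exists_affine_mvPolynomial
      ((LinearMap.fst ℝ ℝ ℝ).comp (Λ.symm : EuclideanSpace ℝ (Fin 2) →ₗ[ℝ] ℝ × ℝ)) O
    obtain ⟨P₂, hP₂⟩ := exists_affine_mvPolynomial
      ((LinearMap.snd ℝ ℝ ℝ).comp (Λ.symm : EuclideanSpace ℝ (Fin 2) →ₗ[ℝ] ℝ × ℝ)) O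
    have hP₁' : ∀ x : EuclideanSpace ℝ (Fin 2),
        MvPolynomial.eval x.ofLp P₁ = (Λ.symm (x - O)).1 := hP₁
    have hP₂' : ∀ x : EuclideanSpace ℝ (Fin 2),
        MvPolynomial.eval x.ofLp P₂ = (Λ.symm (x - O)).2 := hP₂
    refine ⟨P₁ ^ i * P₂ ^ j, ?_, fun z => ?_⟩
    · intro x ξ hξ
      set a := (Λ.symm (x - O)).1
      set b := (Λ.symm (x - O)).2
      have hdeg : ∀ (c d s : ℝ) (k : ℕ), k < r →
          ((Polynomial.C c + Polynomial.C d * Polynomial.X) ^ k * Polynomial.C s).degree < (r : WithBot ℕ) := by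
        intro c d s k hk
        have h1 : ((Polynomial.C c + Polynomial.C d * Polynomial.X) ^ k *
            Polynomial.C s).natDegree ≤ k := by compute_degree
        exact (Polynomial.degree_le_of_natDegree_le h1).trans_lt (by exact_mod_cast hk)
      have heval : ∀ t : ℝ, MvPolynomial.eval (x + t • ξ).ofLp (P₁ ^ i * P₂ ^ j) =
          (a + t * (Λ.symm ξ).1) ^ i * (b + t * (Λ.symm ξ).2) ^ j := by
        intro t
        rw [map_mul, map_pow, map_pow, hP₁', hP₂', add_sub_right_comm, map_add, map_smul]
        rfl
      rcases hΞ ξ hξ with h0 | h0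
      · refine ⟨_, hdeg b (Λ.symm ξ).2 (a ^ i) j hj, fun t => ?_⟩
        rw [heval, h0]
        simp only [Polynomial.eval_mul, Polynomial.eval_pow, Polynomial.eval_add, Polynomial.eval_C,
          Polynomial.eval_X]
        ring
      · refine ⟨_, hdeg a (Λ.symm ξ).1 (b ^ j) i hi, fun t => ?_⟩
        rw [heval, h0]
        simp only [Polynomial.eval_mul, Polynomial.eval_pow, Polynomial.eval_add, Polynomial.eval_C,
          Polynomial.eval_X]
        ring
    · rw [map_mul, map_pow, map_pow, hP₁', hP₂']
      simp
  | zero => exact ⟨0, fun x ξ _ => ⟨0, by simp, by simp⟩, by simp⟩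
  | add f g _ _ hf hg =>
    obtain ⟨P, hP, hPe⟩ := hf
    obtain ⟨Q, hQ, hQe⟩ := hg
    refine ⟨P + Q, fun x ξ hξ => ?_, fun z => by rw [map_add, hPe, hQe]; rfl⟩
    obtain ⟨s, hs, hse⟩ := hP x ξ hξ
    obtain ⟨t, ht, hte⟩ := hQ x ξ hξ
    exact ⟨s + t, (Polynomial.degree_add_le _ _).trans_lt (max_lt hs ht), fun τ => by
      rw [map_add, hse, hte, Polynomial.eval_add]⟩
  | smul c f _ hf =>
    obtain ⟨P, hP, hPe⟩ := hf
    refine ⟨c • P, fun x ξ hξ => ?_, fun z => by rw [MvPolynomial.smul_eval, hPe]; rfl⟩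
    obtain ⟨s, hs, hse⟩ := hP x ξ hξ
    exact ⟨c • s, (Polynomial.degree_smul_le _ _).trans_lt hs, fun τ => by
      rw [MvPolynomial.smul_eval, hse, Polynomial.eval_smul, smul_eq_mul]⟩

lemma exists_dirError_le {p : ℝ≥0∞} (hp : 0 < p) {r : ℕ} (hr : 1 ≤ r) :
    ∃ C : ℝ≥0, ∀ G : Set (EuclideanSpace ℝ (Fin 2)), Convex ℝ G → IsCompact G →
      ∀ O e₁ e₂ : EuclideanSpace ℝ (Fin 2), LinearIndependent ℝ ![e₁, e₂] →
      O + e₁ ∈ G → O + e₂ ∈ G →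
      (∀ s t : ℝ, O + s • e₁ + t • e₂ ∈ G →
        |s| ≤ 1 ∧ |t| ≤ 1 ∧ O + s • e₁ ∈ G ∧ O + t • e₂ ∈ G) →
      ∀ f : EuclideanSpace ℝ (Fin 2) → ℝ, MemSpace p G f →
        dirError r f {‖e₁‖⁻¹ • e₁, ‖e₂‖⁻¹ • e₂} p G ≤
          C * dirModulus r f G {‖e₁‖⁻¹ • e₁, ‖e₂‖⁻¹ • e₂} p := by
  obtain ⟨C, R, hR, hmain⟩ := exists_poly_near_crossBody hp hr
  have hs := subExp_pos hp
  -- The inverse exponent undoes the power of the quasi-norm used throughout.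
  refine ⟨C ^ (subExp p)⁻¹, fun G hconv hcomp O e₁ e₂ hind h₁ h₂ h f hf => ?_⟩
  have hR0 : (0 : ℝ) < R := by
    have : (2 : ℝ) ≤ R := by exact_mod_cast hR
    linarith
  have hn₁ : 0 < ‖e₁‖ := norm_pos_iff.2 (by simpa using hind.ne_zero 0)
  have hn₂ : 0 < ‖e₂‖ := norm_pos_iff.2 (by simpa using hind.ne_zero 1)
  set Ξ : Set (EuclideanSpace ℝ (Fin 2)) := {‖e₁‖⁻¹ • e₁, ‖e₂‖⁻¹ • e₂} with hΞ
  have hind' : LinearIndependent ℝ ![(R : ℝ)⁻¹ • e₁, (R : ℝ)⁻¹ • e₂] := by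
    rw [LinearIndependent.pair_iff] at hind ⊢
    intro s t hst
    have := hind (s * (R : ℝ)⁻¹) (t * (R : ℝ)⁻¹) (by rwa [mul_smul, mul_smul])
    simpa [hR0.ne'] using this
  obtain ⟨Λ, hΛ⟩ := exists_coordinates (by simp) hind'
  have hK := isCrossBody_preimage hconv hcomp h₁ h₂ h hR0 Λ hΛ
  have hΛ₁ : Λ (1, 0) = ((R : ℝ)⁻¹ * ‖e₁‖) • (‖e₁‖⁻¹ • e₁) := by
    rw [hΛ, smul_smul _ ‖e₁‖⁻¹, mul_assoc, mul_inv_cancel₀ hn₁.ne']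
    simp
  have hΛ₂ : Λ (0, 1) = ((R : ℝ)⁻¹ * ‖e₂‖) • (‖e₂‖⁻¹ • e₂) := by
    rw [hΛ, smul_smul _ ‖e₂‖⁻¹, mul_assoc, mul_inv_cancel₀ hn₂.ne']
    simp
  have hu₁ : ‖‖e₁‖⁻¹ • e₁‖ = 1 := by rw [norm_smul, norm_inv, norm_norm, inv_mul_cancel₀ hn₁.ne']
  have hu₂ : ‖‖e₂‖⁻¹ • e₂‖ = 1 := by rw [norm_smul, norm_inv, norm_norm, inv_mul_cancel₀ hn₂.ne']
  obtain ⟨g, hg, hgfin, hgerr, hgdiff⟩ := exists_measurable_representative hcomp hf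
  have hω : dirModulus r f G Ξ p = dirModulus r g G Ξ p := by
    unfold dirModulus dirModulusAt
    simp only [hgdiff]
  set ω := dirModulus r g G Ξ p with hωdef
  have hΦm : Measurable fun z : ℝ × ℝ => O + Λ z := Λ.continuous.measurable.const_add O
  -- Pulling Lebesgue measure back instead of comparing it with the standard one avoids a Jacobian,
  -- since the bounds are uniform over Haar measures.
  set μ : Measure (ℝ × ℝ) := Measure.map Λ.symm volume with hμ
  have hFm : Measurable fun z => g (O + Λ z) := hg.comp hΦm
  have hKm : MeasurableSet {z | O + Λ z ∈ G} := hΦm hcomp.measurableSet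
  have hord : OrderBound p μ r {z | O + Λ z ∈ G} (fun z => g (O + Λ z)) (ω ^ subExp p) := by
    refine orderBound_of_pos hp hr hKm hFm ?_
    rintro e (rfl | rfl) u hu
    · exact lpMod_fwdDiff_iter_le_dirModulus Λ O hp hr hconv hcomp hg (Or.inl rfl) hu₁
        (by positivity) hΛ₁ hu
    · exact lpMod_fwdDiff_iter_le_dirModulus Λ O hp hr hconv hcomp hg (Or.inr rfl) hu₂
        (by positivity) hΛ₂ hu
  have hfin : ∀ L, lpMod p μ (box L) (fun z => g (O + Λ z)) ≠ ∞ := by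
    intro L
    refine ne_top_of_le_ne_top ?_ (lpMod_mono (subset_univ _))
    have := lpMod_comp_coordinates Λ O p MeasurableSet.univ hg
    simp only [mem_univ, ofPred_true] at this
    rw [this]
    exact ENNReal.rpow_ne_top_of_nonneg hs.le hgfin
  obtain ⟨q, hq, hqle⟩ := hmain μ _ hK _ hFm hfin _ hord
  obtain ⟨Q, hQ, hQe⟩ := exists_dirPoly_of_mem_polySpace Λ O (Ξ := Ξ) (by
    rintro ξ (rfl | rfl)
    · right
      have : ‖e₁‖⁻¹ • e₁ = Λ ((R * ‖e₁‖⁻¹) • (1, 0)) := by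
        rw [map_smul, hΛ₁, smul_smul, smul_smul]
        congr 1
        field_simp
      rw [this]
      simp
    · left
      have : ‖e₂‖⁻¹ • e₂ = Λ ((R * ‖e₂‖⁻¹) • (0, 1)) := by
        rw [map_smul, hΛ₂, smul_smul, smul_smul]
        congr 1
        field_simp
      rw [this]
      simp) hq
  have hQm : Measurable fun x : EuclideanSpace ℝ (Fin 2) => MvPolynomial.eval x.ofLp Q :=
    (MvPolynomial.continuous_eval Q).measurable.comp (PiLp.continuous_ofLp 2 _).measurable
  have hle : pNorm p G (fun x => g x - MvPolynomial.eval x.ofLp Q) ^ subExp p ≤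
      C * ω ^ subExp p := by
    have := lpMod_comp_coordinates Λ O p hcomp.measurableSet
      (g := fun x => g x - MvPolynomial.eval x.ofLp Q) (hg.sub hQm)
    rw [← this]
    simpa only [hQe] using hqle
  rw [hω]
  calc dirError r f Ξ p G ≤ pNorm p G (fun x => f x - MvPolynomial.eval x.ofLp Q) :=
        iInf₂_le Q hQ
    _ = pNorm p G (fun x => g x - MvPolynomial.eval x.ofLp Q) := hgerr _
    _ ≤ (C * ω ^ subExp p) ^ (subExp p)⁻¹ := (ENNReal.le_rpow_inv_iff hs).2 hle
    _ = (C ^ (subExp p)⁻¹ : ℝ≥0) * ω := by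
        rw [ENNReal.mul_rpow_of_nonneg _ _ (by positivity), ← ENNReal.rpow_mul,
          mul_inv_cancel₀ hs.ne', ENNReal.rpow_one, ENNReal.coe_rpow_of_nonneg _ (by positivity)]

end Transfer

end DirectionalWhitney

theorem mainTheorem11 :
    ∃ C : ℝ≥0∞ → ℕ → ℝ≥0,
      ∀ G : Set (EuclideanSpace ℝ (Fin 2)), Convex ℝ G → IsCompact G → (interior G).Nonempty →
        ∃ ξ₁ ξ₂ : EuclideanSpace ℝ (Fin 2),
          ‖ξ₁‖ = 1 ∧ ‖ξ₂‖ = 1 ∧ LinearIndependent ℝ ![ξ₁, ξ₂] ∧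
          ∀ r : ℕ, 1 ≤ r → ∀ p : ℝ≥0∞, 0 < p →
            ∀ f : EuclideanSpace ℝ (Fin 2) → ℝ, DirectionalWhitney.MemSpace p G f →
              DirectionalWhitney.dirError r f {ξ₁, ξ₂} p G ≤
                (C p r : ℝ≥0∞) * DirectionalWhitney.dirModulus r f G {ξ₁, ξ₂} p := by
  choose! C hC using fun (p : ℝ≥0∞) (hp : 0 < p) (r : ℕ) (hr : 1 ≤ r) =>
    DirectionalWhitney.exists_dirError_le hp hr
  refine ⟨C, fun G hconv hcomp hint => ?_⟩
  -- The chords depend on G only, so the directions are fixed before r, p and f.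
  obtain ⟨O, e₁, e₂, hind, h₁, h₂, h⟩ :=
    DirectionalWhitney.exists_crossing_chords hconv hcomp hint
  have hn₁ : ‖e₁‖ ≠ 0 := norm_ne_zero_iff.2 (by simpa using hind.ne_zero 0)
  have hn₂ : ‖e₂‖ ≠ 0 := norm_ne_zero_iff.2 (by simpa using hind.ne_zero 1)
  refine ⟨‖e₁‖⁻¹ • e₁, ‖e₂‖⁻¹ • e₂, ?_, ?_, ?_, ?_⟩
  · rw [norm_smul, norm_inv, norm_norm, inv_mul_cancel₀ hn₁]
  · rw [norm_smul, norm_inv, norm_norm, inv_mul_cancel₀ hn₂]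
  · rw [LinearIndependent.pair_iff] at hind ⊢
    intro s t hst
    have := hind (s * ‖e₁‖⁻¹) (t * ‖e₂‖⁻¹) (by rwa [mul_smul, mul_smul])
    simpa [norm_ne_zero_iff.1 hn₁, norm_ne_zero_iff.1 hn₂] using this
  · exact fun r hr p hp f hf => hC p hp r hr G hconv hcomp O e₁ e₂ hind h₁ h₂ h f hf
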